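/- Let $C=\mathbb{R}+e\mathbb{R}$, $e^2=1$, be the algebra of para-complex numbers; for $z=x+ey$ put $\mathrm{Re}\,z=x$. A para-complex structure $J$ on a finite-dimensional smooth manifold $M$ is a smooth field of endomorphisms of $TM$ with $J^2=\mathrm{Id}$, $J\ne\pm\mathrm{Id}$, whose $\pm1$-eigendistributions have equal rank and are integrable (involutive). Then $T_xM$ is a $C$-module with $e$ acting as $J_x$; through $X\mapsto\hat X=\frac12(X+eJX)$ it is identified with the para-holomorphic tangent space $T^{1,0}_xM$. Smooth maps whose differentials commute with the para-complex structures are called para-holomorphic. A para-complex Lie group is a Lie group $G$ with a para-complex structure $J$ for which multiplication and inversion are para-holomorphic. Let $(G,J)$ be a para-complex Lie group, let $(e_a)_{1\le a\le m}$ be a $C$-basis of $T^{1,0}_1G$, let $C^a_{bc}\in C$ be the structure constants, $[e_b,e_c]=C^a_{bc}e_a$, and let $C_{ab}=C^c_{ad}C^d_{bc}$ be the para-complex Cartan–Killing form. Assume that $G$ is semi-simple, i.e. that this form is nondegenerate: $\det(C_{ab})$ is invertible in $C$. Let $\lambda^a=\lambda^a_b\,dz^b$ be the right-invariant para-holomorphic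 $1$-forms: $\lambda^a$ at $z\in G$ is the $a$-th component of the differential at $z$ of the right translation by $z^{-1}$, so that $\lambda^a$ at the identity is the basis dual to $(e_a)$. Put $$\hat g=g_{ab}\,dz^a\otimes dz^b=C_{pq}\,\lambda^p\otimes\lambda^q,\qquad g_{ab}=C_{pq}\lambda^p_a\lambda^q_b .$$ Curvature is $R(X,Y)Z=\nabla_X\nabla_YZ-\nabla_Y\nabla_XZ-\nabla_{[X,Y]}Z$, and the Ricci tensor is $\mathrm{Ric}(X,Y)=\mathrm{Tr}\{Z\mapsto R(Z,X)Y\}$, with the trace over $\mathbb{R}$ on $T_xG$ for a real metric and over $C$ on $T^{1,0}_xG$ for $\hat g$. Then: 1. $\hat g$ is a para-holomorphic Riemannian metric on $(G,J)$: it is smooth, symmetric, $C$-bilinear and nondegenerate on $T^{1,0}G$, and its values on local para-holomorphic vector fields are para-holomorphic functions. 2. $\hat g$ has a Levi-Civita connection (torsion-free, $\nabla J=0$, $\nabla\hat g=0$), and its para-holomorphic Ricci tensor satisfies $R_{ab}=-\frac14 g_{ab}$. 3. The real tensor $ds^2=2\,\mathrm{Re}\,[g_{ab}\,dz^a\otimes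 dz^b]$ is a para-Kähler Norden metric on $(G,J)$: it is smooth, symmetric, nondegenerate and $J$-invariant, $ds^2(JX,JY)=ds^2(X,Y)$, and its Levi-Civita connection exists and satisfies $\nabla J=0$. 4. $ds^2$ is an Einstein metric with real constant $-\frac14$: $\mathrm{Ric}(ds^2)=-\frac14\,ds^2$. -/

import Mathlib

open scoped Manifold ContDiff Topology Bundle

noncomputable section

namespace ParaComplexGeometry

/-- The algebra `C = ℝ + eℝ` of para-complex numbers `z = x + e y`, with `e² = 1`;
`z.re = x` and `z.im = y`. -/
abbrev ParaComplex : Type := QuadraticAlgebra ℝ 1 0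

/-- The para-complex unit `e`, `e² = 1`. -/
def unitE : ParaComplex := ⟨0, 1⟩

section Manifolds

variable {E : Type*} [NormedAddCommGroup E] [NormedSpace ℝ E]
  {M : Type*} [TopologicalSpace M] [ChartedSpace E M]

/-! ### Para-complex structures -/

/-- A para-complex structure on a smooth manifold `M` modelled on `E`: a smooth field `J` of
endomorphisms of the tangent spaces with `J² = Id`, `J ≠ ± Id`, whose eigenspaces for `1` and `-1`
have the same dimension at each point, and such that the two eigendistributions are
integrable (involutive). -/
structure ParaComplexStructure (E : Type*) [NormedAddCommGroup E] [NormedSpace ℝ E]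
    (M : Type*) [TopologicalSpace M] [ChartedSpace E M] [IsManifold 𝓘(ℝ, E) ∞ M] where
  toFun : ∀ x : M, TangentSpace 𝓘(ℝ, E) x →L[ℝ] TangentSpace 𝓘(ℝ, E) x
  contMDiff_toFun : ContMDiff 𝓘(ℝ, E) (𝓘(ℝ, E).prod 𝓘(ℝ, E →L[ℝ] E)) ∞
    (fun x : M ↦ (⟨x, toFun x⟩ : Bundle.TotalSpace (E →L[ℝ] E)
      (fun x : M ↦ TangentSpace 𝓘(ℝ, E) x →L[ℝ] TangentSpace 𝓘(ℝ, E) x)))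
  apply_apply : ∀ (x : M) (v : TangentSpace 𝓘(ℝ, E) x), toFun x (toFun x v) = v
  ne_id : ∀ x : M, toFun x ≠ ContinuousLinearMap.id ℝ (TangentSpace 𝓘(ℝ, E) x)
  ne_neg_id : ∀ x : M, toFun x ≠ -ContinuousLinearMap.id ℝ (TangentSpace 𝓘(ℝ, E) x)
  finrank_eq : ∀ x : M,
    Module.finrank ℝ (Module.End.eigenspace (toFun x).toLinearMap (1 : ℝ)) =
      Module.finrank ℝ (Module.End.eigenspace (toFun x).toLinearMap (-1 : ℝ))
  integrable_pos : ∀ (x : M) (X Y : ∀ y : M, TangentSpace 𝓘(ℝ, E) y),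
    CMDiffAt ∞ (T% X) x → CMDiffAt ∞ (T% Y) x →
    (∀ᶠ y in 𝓝 x, toFun y (X y) = X y) → (∀ᶠ y in 𝓝 x, toFun y (Y y) = Y y) →
    toFun x (VectorField.mlieBracket 𝓘(ℝ, E) X Y x) = VectorField.mlieBracket 𝓘(ℝ, E) X Y x
  integrable_neg : ∀ (x : M) (X Y : ∀ y : M, TangentSpace 𝓘(ℝ, E) y),
    CMDiffAt ∞ (T% X) x → CMDiffAt ∞ (T% Y) x →
    (∀ᶠ y in 𝓝 x, toFun y (X y) = -X y) → (∀ᶠ y in 𝓝 x, toFun y (Y y) = -Y y) →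
    toFun x (VectorField.mlieBracket 𝓘(ℝ, E) X Y x) = -VectorField.mlieBracket 𝓘(ℝ, E) X Y x

/-- A map `f : (M, J) → (M', J')` is para-holomorphic if it is smooth and `df ∘ J = J' ∘ df`. -/
def IsParaHolomorphicMap {E' : Type*} [NormedAddCommGroup E'] [NormedSpace ℝ E']
    {H H' : Type*} [TopologicalSpace H] [TopologicalSpace H']
    (I : ModelWithCorners ℝ E H) (I' : ModelWithCorners ℝ E' H')
    {N N' : Type*} [TopologicalSpace N] [ChartedSpace H N] [TopologicalSpace N']
    [ChartedSpace H' N']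
    (J : ∀ x : N, TangentSpace I x →L[ℝ] TangentSpace I x)
    (J' : ∀ x : N', TangentSpace I' x →L[ℝ] TangentSpace I' x) (f : N → N') : Prop :=
  ContMDiff I I' ∞ f ∧
    ∀ (x : N) (v : TangentSpace I x), mfderiv I I' f x (J x v) = J' (f x) (mfderiv I I' f x v)

variable [IsManifold 𝓘(ℝ, E) ∞ M]

/-- The product para-complex structure `J × J` on `T_{(x, y)}(M × M) = T_x M × T_y M`. -/
def prodStructure (J : ParaComplexStructure E M) (p : M × M) :
    TangentSpace (𝓘(ℝ, E).prod 𝓘(ℝ, E)) p →L[ℝ] TangentSpace (𝓘(ℝ, E).prod 𝓘(ℝ, E)) p :=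
  ContinuousLinearMap.prodMap (J.toFun p.1) (J.toFun p.2)

/-- The tangent space `T_x M` regarded as a module over the para-complex numbers, where `e` acts
as `J_x`. The map `X ↦ (X + e J X) / 2` is a `C`-linear isomorphism from it onto the
`e`-eigenspace `T_x^{1,0} M` of `J` in `T_x M ⊗ C`. For a para-holomorphic coordinate system
`(z^a)` the differentials `dz^a` are `C`-linear functionals on it, and they form the basis dual
to the basis `∂/∂x^a`, which corresponds to the basis `∂/∂z^a` of `T_x^{1,0} M`. -/
def HolTangent (_J : ParaComplexStructure E M) (x : M) : Type _ := TangentSpace 𝓘(ℝ, E) x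

instance (J : ParaComplexStructure E M) (x : M) : AddCommGroup (HolTangent J x) :=
  inferInstanceAs (AddCommGroup (TangentSpace 𝓘(ℝ, E) x))

/-- The identity map `T_x M → HolTangent J x`. -/
def toHol (J : ParaComplexStructure E M) {x : M} (v : TangentSpace 𝓘(ℝ, E) x) : HolTangent J x :=
  v

/-- The identity map `HolTangent J x → T_x M`. -/
def ofHol (J : ParaComplexStructure E M) {x : M} (v : HolTangent J x) : TangentSpace 𝓘(ℝ, E) x :=
  v

/-- `(x + e y) • v = x v + y J v`. -/
instance (J : ParaComplexStructure E M) (x : M) : Module ParaComplex (HolTangent J x) where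
  smul z v := toHol J (z.re • ofHol J v + z.im • J.toFun x (ofHol J v))
  one_smul v := by
    change (1 : ℝ) • ofHol J v + (0 : ℝ) • J.toFun x (ofHol J v) = ofHol J v
    simp
  mul_smul z w v := by
    change (z * w).re • ofHol J v + (z * w).im • J.toFun x (ofHol J v) =
      z.re • (w.re • ofHol J v + w.im • J.toFun x (ofHol J v)) +
        z.im • J.toFun x (w.re • ofHol J v + w.im • J.toFun x (ofHol J v))
    simp only [map_add, map_smul, J.apply_apply, QuadraticAlgebra.re_mul, QuadraticAlgebra.im_mul]
    module
  smul_zero z := by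
    change z.re • (0 : TangentSpace 𝓘(ℝ, E) x) + z.im • J.toFun x 0 = 0
    simp
  smul_add z v w := by
    change z.re • (ofHol J v + ofHol J w) + z.im • J.toFun x (ofHol J v + ofHol J w) =
      (z.re • ofHol J v + z.im • J.toFun x (ofHol J v)) +
        (z.re • ofHol J w + z.im • J.toFun x (ofHol J w))
    simp only [map_add]
    module
  add_smul z w v := by
    change (z + w).re • ofHol J v + (z + w).im • J.toFun x (ofHol J v) =
      (z.re • ofHol J v + z.im • J.toFun x (ofHol J v)) +
        (w.re • ofHol J v + w.im • J.toFun x (ofHol J v))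
    simp only [QuadraticAlgebra.re_add, QuadraticAlgebra.im_add]
    module
  zero_smul v := by
    change (0 : ℝ) • ofHol J v + (0 : ℝ) • J.toFun x (ofHol J v) = 0
    simp

/-! ### Connections, curvature and Ricci tensors -/

section Curvature

/-- A covariant derivative on the tangent bundle; `cov Y x v` is `∇_v Y` at the point `x`. -/
abbrev AffineConnection (E : Type*) [NormedAddCommGroup E] [NormedSpace ℝ E]
    (M : Type*) [TopologicalSpace M] [ChartedSpace E M] [IsManifold 𝓘(ℝ, E) ∞ M] :=
  CovariantDerivative 𝓘(ℝ, E) E (TangentSpace 𝓘(ℝ, E) : M → Type _)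

/-- `R(X, Y) Z = ∇_X ∇_Y Z - ∇_Y ∇_X Z - ∇_{[X, Y]} Z`, for vector fields. -/
def curvature (cov : AffineConnection E M) (X Y Z : ∀ x : M, TangentSpace 𝓘(ℝ, E) x) (x : M) :
    TangentSpace 𝓘(ℝ, E) x :=
  cov (fun y ↦ cov Z y (Y y)) x (X x) - cov (fun y ↦ cov Z y (X y)) x (Y x) -
    cov Z x (VectorField.mlieBracket 𝓘(ℝ, E) X Y x)

/-- The curvature `R_x(u, v) w` on tangent vectors at `x`: the value at `x` of the curvature of
extensions of `u, v, w` to vector fields that are smooth near `x` (the curvature of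
a smooth connection is tensorial, so the extensions do not matter). -/
def curvatureAt (cov : AffineConnection E M) (x : M) (u v w : TangentSpace 𝓘(ℝ, E) x) :
    TangentSpace 𝓘(ℝ, E) x :=
  curvature cov (FiberBundle.extend E u) (FiberBundle.extend E v) (FiberBundle.extend E w) x

/-- `Ric(u, v) = Tr {w ↦ R(w, u) v}`, the trace over `ℝ` being computed in the basis `b` of
`T_x M`. -/
def ricci (cov : AffineConnection E M) {x : M} {ι : Type*} [Fintype ι]
    (b : Module.Basis ι ℝ (TangentSpace 𝓘(ℝ, E) x)) (u v : TangentSpace 𝓘(ℝ, E) x) : ℝ :=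
  ∑ i, b.repr (curvatureAt cov x (b i) u v) i

/-- The para-holomorphic Ricci tensor `Tr_C {w ↦ R(w, u) v}`, the trace over the para-complex
numbers being computed in the `C`-basis `b` of `T_x^{1,0} M`. -/
def paraRicci (J : ParaComplexStructure E M) (cov : AffineConnection E M) {x : M}
    {ι : Type*} [Fintype ι] (b : Module.Basis ι ParaComplex (HolTangent J x))
    (u v : TangentSpace 𝓘(ℝ, E) x) : ParaComplex :=
  ∑ i, b.repr (toHol J (curvatureAt cov x (ofHol J (b i)) u v)) i

/-- A connection is almost para-complex if `∇J = 0`, that is `∇_v (J Y) = J ∇_v Y`. -/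
def IsAlmostParaComplex (J : ParaComplexStructure E M) (cov : AffineConnection E M) : Prop :=
  ∀ (x : M) (Y : ∀ y : M, TangentSpace 𝓘(ℝ, E) y), MDiffAt (T% Y) x →
    ∀ v : TangentSpace 𝓘(ℝ, E) x, cov (fun y ↦ J.toFun y (Y y)) x v = J.toFun x (cov Y x v)

variable [FiniteDimensional ℝ E] [CompleteSpace E]

/-- `∇` is a Levi-Civita connection of `g`: torsion-free with `∇g = 0`. -/
def IsLeviCivita (g : ∀ x : M, LinearMap.BilinForm ℝ (TangentSpace 𝓘(ℝ, E) x))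
    (cov : AffineConnection E M) : Prop :=
  CovariantDerivative.torsion cov = 0 ∧
    ∀ (x : M) (X Y : ∀ y : M, TangentSpace 𝓘(ℝ, E) y), MDiffAt (T% X) x → MDiffAt (T% Y) x →
      ∀ v : TangentSpace 𝓘(ℝ, E) x,
        mvfderiv 𝓘(ℝ, E) (fun y ↦ g y (X y) (Y y)) x v =
          g x (cov X x v) (Y x) + g x (X x) (cov Y x v)

/-! ### Real metrics -/

/-- `g` is a smooth symmetric nondegenerate metric on `M` (of any signature). -/
structure IsPseudoRiemannian (g : ∀ x : M, LinearMap.BilinForm ℝ (TangentSpace 𝓘(ℝ, E) x)) :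
    Prop where
  symm : ∀ (x : M) (u v : TangentSpace 𝓘(ℝ, E) x), g x u v = g x v u
  nondegenerate : ∀ x : M, (g x).Nondegenerate
  smooth : ∀ (x : M) (X Y : ∀ y : M, TangentSpace 𝓘(ℝ, E) y),
    CMDiffAt ∞ (T% X) x → CMDiffAt ∞ (T% Y) x →
    ContMDiffAt 𝓘(ℝ, E) 𝓘(ℝ, ℝ) ∞ (fun y ↦ g y (X y) (Y y)) x

/-- `g` is a para-Norden metric on `(M, J)`: a metric with `g(JX, JY) = g(X, Y)`. -/
structure IsParaNorden (J : ParaComplexStructure E M)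
    (g : ∀ x : M, LinearMap.BilinForm ℝ (TangentSpace 𝓘(ℝ, E) x)) : Prop
    extends IsPseudoRiemannian g where
  compat : ∀ (x : M) (u v : TangentSpace 𝓘(ℝ, E) x), g x (J.toFun x u) (J.toFun x v) = g x u v

/-- `g` is a para-Kähler Norden metric on `(M, J)`: a para-Norden metric whose Levi-Civita
connection is almost para-complex. -/
structure IsParaKahlerNorden (J : ParaComplexStructure E M)
    (g : ∀ x : M, LinearMap.BilinForm ℝ (TangentSpace 𝓘(ℝ, E) x)) : Prop
    extends IsParaNorden J g where
  exists_leviCivita : ∃ cov : AffineConnection E M, IsLeviCivita g cov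
  parallel : ∀ cov : AffineConnection E M, IsLeviCivita g cov → IsAlmostParaComplex J cov

/-- `Ric(g) = c g`, where `Ric(g)` is the Ricci tensor of the Levi-Civita connection of `g`. -/
def IsEinsteinWith (g : ∀ x : M, LinearMap.BilinForm ℝ (TangentSpace 𝓘(ℝ, E) x)) (c : ℝ) : Prop :=
  (∃ cov : AffineConnection E M, IsLeviCivita g cov) ∧
  ∀ cov : AffineConnection E M, IsLeviCivita g cov →
    ∀ (x : M) (n : ℕ) (b : Module.Basis (Fin n) ℝ (TangentSpace 𝓘(ℝ, E) x))
      (u v : TangentSpace 𝓘(ℝ, E) x), ricci cov b u v = c * g x u v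

/-! ### Para-complex valued metrics -/

/-- The derivative of a para-complex valued function in the direction of `v ∈ T_x M`. -/
def paraDeriv (f : M → ParaComplex) (x : M) (v : TangentSpace 𝓘(ℝ, E) x) : ParaComplex :=
  ⟨mvfderiv 𝓘(ℝ, E) (fun y ↦ (f y).re) x v, mvfderiv 𝓘(ℝ, E) (fun y ↦ (f y).im) x v⟩

/-- `X` is smooth near `x` and the vector field `(X + e J X) / 2` is para-holomorphic near `x`,
that is `(L_X J) Y = [X, J Y] - J [X, Y] = 0` for all vector fields `Y`. -/
def IsParaHolomorphicFieldAt (J : ParaComplexStructure E M)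
    (X : ∀ y : M, TangentSpace 𝓘(ℝ, E) y) (x : M) : Prop :=
  CMDiffAt ∞ (T% X) x ∧
    ∀ᶠ y in 𝓝 x, ∀ Y : ∀ y : M, TangentSpace 𝓘(ℝ, E) y, CMDiffAt ∞ (T% Y) y →
      VectorField.mlieBracket 𝓘(ℝ, E) X (fun y' ↦ J.toFun y' (Y y')) y =
        J.toFun y (VectorField.mlieBracket 𝓘(ℝ, E) X Y y)

/-- `G` is a para-holomorphic Riemannian metric on `(M, J)`: a field of symmetric, nondegenerate,
`C`-bilinear `C`-valued forms on the `C`-modules `T_x^{1,0} M`, whose values on local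
para-holomorphic vector fields are para-holomorphic functions `f`, `df(J v) = e df(v)`. -/
structure IsParaHolomorphicMetric (J : ParaComplexStructure E M)
    (G : ∀ x : M, TangentSpace 𝓘(ℝ, E) x →ₗ[ℝ] TangentSpace 𝓘(ℝ, E) x →ₗ[ℝ] ParaComplex) :
    Prop where
  symm : ∀ (x : M) (u v : TangentSpace 𝓘(ℝ, E) x), G x u v = G x v u
  unitE_mul : ∀ (x : M) (u v : TangentSpace 𝓘(ℝ, E) x), G x (J.toFun x u) v = unitE * G x u v
  nondegenerate : ∀ (x : M) (u : TangentSpace 𝓘(ℝ, E) x), (∀ v, G x u v = 0) → u = 0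
  smooth : ∀ (x : M) (X Y : ∀ y : M, TangentSpace 𝓘(ℝ, E) y),
    CMDiffAt ∞ (T% X) x → CMDiffAt ∞ (T% Y) x →
    ContMDiffAt 𝓘(ℝ, E) 𝓘(ℝ, ℝ) ∞ (fun y ↦ (G y (X y) (Y y)).re) x ∧
    ContMDiffAt 𝓘(ℝ, E) 𝓘(ℝ, ℝ) ∞ (fun y ↦ (G y (X y) (Y y)).im) x
  paraHolomorphic : ∀ (x : M) (X Y : ∀ y : M, TangentSpace 𝓘(ℝ, E) y),
    IsParaHolomorphicFieldAt J X x → IsParaHolomorphicFieldAt J Y x →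
    ∀ v : TangentSpace 𝓘(ℝ, E) x,
      paraDeriv (fun y ↦ G y (X y) (Y y)) x (J.toFun x v) =
        unitE * paraDeriv (fun y ↦ G y (X y) (Y y)) x v

/-- `∇` is a Levi-Civita connection of the para-complex valued metric `G` on `T^{1,0} M`:
torsion-free, almost para-complex (so that it acts on `T^{1,0} M`), and with `∇G = 0`. -/
def IsParaLeviCivita (J : ParaComplexStructure E M)
    (G : ∀ x : M, TangentSpace 𝓘(ℝ, E) x →ₗ[ℝ] TangentSpace 𝓘(ℝ, E) x →ₗ[ℝ] ParaComplex)
    (cov : AffineConnection E M) : Prop :=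
  CovariantDerivative.torsion cov = 0 ∧ IsAlmostParaComplex J cov ∧
    ∀ (x : M) (X Y : ∀ y : M, TangentSpace 𝓘(ℝ, E) y), MDiffAt (T% X) x → MDiffAt (T% Y) x →
      ∀ v : TangentSpace 𝓘(ℝ, E) x,
        paraDeriv (fun y ↦ G y (X y) (Y y)) x v =
          G x (cov X x v) (Y x) + G x (X x) (cov Y x v)

/-- The para-holomorphic Ricci tensor of `G` equals `c G`. -/
def IsParaHolomorphicEinsteinWith (J : ParaComplexStructure E M)
    (G : ∀ x : M, TangentSpace 𝓘(ℝ, E) x →ₗ[ℝ] TangentSpace 𝓘(ℝ, E) x →ₗ[ℝ] ParaComplex)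
    (c : ParaComplex) : Prop :=
  (∃ cov : AffineConnection E M, IsParaLeviCivita J G cov) ∧
  ∀ cov : AffineConnection E M, IsParaLeviCivita J G cov →
    ∀ (x : M) (n : ℕ) (b : Module.Basis (Fin n) ParaComplex (HolTangent J x))
      (u v : TangentSpace 𝓘(ℝ, E) x), paraRicci J cov b u v = c * G x u v

end Curvature

/-- The real metric `2 Re G`. -/
def twoRe (G : ∀ x : M, TangentSpace 𝓘(ℝ, E) x →ₗ[ℝ] TangentSpace 𝓘(ℝ, E) x →ₗ[ℝ] ParaComplex)
    (x : M) : LinearMap.BilinForm ℝ (TangentSpace 𝓘(ℝ, E) x) :=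
  (G x).compr₂ ((2 : ℝ) • QuadraticAlgebra.reₗ 1 0)

end Manifolds

/-! ### Para-complex Lie groups -/

section LieGroups

variable {E : Type*} [NormedAddCommGroup E] [NormedSpace ℝ E]
  {G : Type*} [TopologicalSpace G] [ChartedSpace E G] [Group G] [LieGroup 𝓘(ℝ, E) ∞ G]

/-- `(G, J)` is a para-complex Lie group: multiplication and inversion are para-holomorphic. -/
structure IsParaComplexLieGroup (J : ParaComplexStructure E G) : Prop where
  mul : IsParaHolomorphicMap (𝓘(ℝ, E).prod 𝓘(ℝ, E)) 𝓘(ℝ, E) (prodStructure J) J.toFun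
    (fun p : G × G ↦ p.1 * p.2)
  inv : IsParaHolomorphicMap 𝓘(ℝ, E) 𝓘(ℝ, E) J.toFun J.toFun (fun z : G ↦ z⁻¹)

variable {ι : Type*} [Fintype ι]

/-- The para-complex structure constants `C^a_{bc}`, `[e_b, e_c] = C^a_{bc} e_a`, of the Lie
algebra of `G` in a `C`-basis `(e_a)` of the para-holomorphic tangent space at the identity. -/
def structureConst (J : ParaComplexStructure E G)
    (e : Module.Basis ι ParaComplex (HolTangent J (1 : G))) (a b c : ι) : ParaComplex :=
  e.repr (toHol J (⁅(ofHol J (e b) : GroupLieAlgebra 𝓘(ℝ, E) G),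
    (ofHol J (e c) : GroupLieAlgebra 𝓘(ℝ, E) G)⁆ : GroupLieAlgebra 𝓘(ℝ, E) G)) a

/-- The para-complex Cartan-Killing elements `C_{ab} = C^c_{ad} C^d_{bc}`. -/
def cartanKilling (J : ParaComplexStructure E G)
    (e : Module.Basis ι ParaComplex (HolTangent J (1 : G))) : Matrix ι ι ParaComplex :=
  Matrix.of fun a b ↦ ∑ c, ∑ d, structureConst J e c a d * structureConst J e d b c

/-- The right-invariant para-holomorphic `1`-forms `λ^a`: the components in the basis `e` of the
differential at `z` of the right translation by `z⁻¹`, which maps `T_z G` to `T_1 G`. In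
para-holomorphic coordinates `λ^a = λ^a_b dz^b`. -/
def rightForm (J : ParaComplexStructure E G)
    (e : Module.Basis ι ParaComplex (HolTangent J (1 : G))) (a : ι) (z : G) :
    TangentSpace 𝓘(ℝ, E) z →ₗ[ℝ] ParaComplex where
  toFun v := e.repr (toHol J (x := (1 : G))
    (mfderiv 𝓘(ℝ, E) 𝓘(ℝ, E) (fun w : G ↦ w * z⁻¹) z v)) a
  map_add' u v := by
    rw [map_add]
    exact congrArg (fun f ↦ f a) (map_add e.repr
      (toHol J (x := (1 : G)) (mfderiv 𝓘(ℝ, E) 𝓘(ℝ, E) (fun w : G ↦ w * z⁻¹) z u))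
      (toHol J (x := (1 : G)) (mfderiv 𝓘(ℝ, E) 𝓘(ℝ, E) (fun w : G ↦ w * z⁻¹) z v)))
  map_smul' r v := by
    rw [map_smul]
    have key : ∀ w : TangentSpace 𝓘(ℝ, E) (1 : G),
        toHol J (r • w) = (⟨r, 0⟩ : ParaComplex) • toHol J w := by
      intro w
      change r • w = r • w + (0 : ℝ) • J.toFun 1 w
      simp
    refine (congrArg (fun f ↦ e.repr f a) (key
      (mfderiv 𝓘(ℝ, E) 𝓘(ℝ, E) (fun w : G ↦ w * z⁻¹) z v))).trans ?_
    rw [map_smul, Finsupp.smul_apply, RingHom.id_apply, smul_eq_mul]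
    ext <;> simp [QuadraticAlgebra.re_mul, QuadraticAlgebra.im_mul, QuadraticAlgebra.re_smul,
      QuadraticAlgebra.im_smul]

/-- The para-holomorphic tensor `g_{ab} dz^a ⊗ dz^b` with `g_{ab} = C_{pq} λ^p_a λ^q_b`, that is
`C_{pq} λ^p ⊗ λ^q`. -/
def killingMetric (J : ParaComplexStructure E G)
    (e : Module.Basis ι ParaComplex (HolTangent J (1 : G))) (z : G) :
    TangentSpace 𝓘(ℝ, E) z →ₗ[ℝ] TangentSpace 𝓘(ℝ, E) z →ₗ[ℝ] ParaComplex :=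
  LinearMap.mk₂ ℝ
    (fun u v ↦ ∑ p, ∑ q, cartanKilling J e p q * rightForm J e p z u * rightForm J e q z v)
    (fun u u' v ↦ by
      simp only [map_add, mul_add, add_mul, Finset.sum_add_distrib])
    (fun r u v ↦ by
      simp only [map_smul, mul_smul_comm, smul_mul_assoc, Finset.smul_sum])
    (fun u v v' ↦ by
      simp only [map_add, mul_add, Finset.sum_add_distrib])
    (fun r u v ↦ by
      simp only [map_smul, mul_smul_comm, Finset.smul_sum])

/-- `G` is semi-simple: the Cartan-Killing form is nondegenerate, that is, `det (C_{ab})` is an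
invertible para-complex number. -/
def IsParaSemisimple [DecidableEq ι] (J : ParaComplexStructure E G)
    (e : Module.Basis ι ParaComplex (HolTangent J (1 : G))) : Prop :=
  IsUnit (cartanKilling J e).det

end LieGroups

end ParaComplexGeometry

end

noncomputable section

namespace ParaComplexGeometry

/-! ### Derivatives of vector valued functions on manifolds -/

section Calculus

variable {E : Type*} [NormedAddCommGroup E] [NormedSpace ℝ E]
  {M : Type*} [TopologicalSpace M] [ChartedSpace E M]
  {F F₁ F₂ : Type*} [NormedAddCommGroup F] [NormedSpace ℝ F]
  [NormedAddCommGroup F₁] [NormedSpace ℝ F₁] [NormedAddCommGroup F₂] [NormedSpace ℝ F₂]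

/-! Right translations identify every tangent space of G with the Lie algebra T_1 G. In this
trivialization J and the bracket do not depend on the point: multiplication is para-holomorphic, so
J is right-invariant and Ad_z commutes with J_1, and differentiating Ad at 1 shows that the Lie
bracket is C-bilinear. Since C_{ab} is the trace over C of ad e_a ∘ ad e_b, the tensor ĝ is the
para-complex Killing form K, transported by right translations. It is nondegenerate because its Gram
matrix has an invertible determinant, and K([a,b],c) + K(b,[a,c]) = 0 by the Jacobi identity and the
cyclicity of the trace.

In the right-invariant frame put ∇_v Y = dY(v) + [v,Y]/2, with the bracket of right-invariant
fields. The factor 1/2 removes the torsion, ad-invariance of K gives ∇ĝ = 0 and ∇ds² = 0, and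
C-bilinearity gives ∇J = 0. By the Jacobi identity R(X,Y)Z = -[[X,Y],Z]/4, hence w ↦ R(w,u)v is -1/4
ad v ∘ ad u, whose trace over C is -K(u,v)/4. The real trace of a C-linear map is twice the real
part of its trace over C, so the same computation gives Ric(ds²) = -ds²/4.

The Einstein conditions and ∇J = 0 are asserted for every Levi-Civita connection, so uniqueness is
needed. ds² is nondegenerate since Re(ez) = Im z, so its Levi-Civita connection is unique on
differentiable fields; and a Levi-Civita connection of ĝ is one of ds², by taking real parts.

The main steps are `Parallelism.torsion_connection`, `Parallelism.coframe_curvature_connection`,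
`IsLeviCivita.apply_eq`, `mlieBracket_rightField_leftField`,
`IsParaComplexLieGroup.groupBracket_structureAt`, `killing_invariant` and
`trace_restrictScalars_paraComplex`. -/

lemma mvfderiv_congr {f g : M → F} {x : M} (h : f =ᶠ[𝓝 x] g) :
    mvfderiv 𝓘(ℝ, E) f x = mvfderiv 𝓘(ℝ, E) g x := by
  have := h.mfderiv_eq (I := 𝓘(ℝ, E)) (I' := 𝓘(ℝ, F))
  ext v
  exact congrArg (fun L : E →L[ℝ] F ↦ L v) this

lemma mvfderiv_clm_comp (L : F →L[ℝ] F₁) {f : M → F} {x : M}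
    (hf : MDifferentiableAt 𝓘(ℝ, E) 𝓘(ℝ, F) f x) (v : TangentSpace 𝓘(ℝ, E) x) :
    mvfderiv 𝓘(ℝ, E) (fun y ↦ L (f y)) x v = L (mvfderiv 𝓘(ℝ, E) f x v) := by
  have h1 : HasMFDerivAt 𝓘(ℝ, F) 𝓘(ℝ, F₁) L (f x) L := L.hasMFDerivAt
  have h2 := (h1.comp x hf.hasMFDerivAt).mfderiv
  exact congrArg (fun A : E →L[ℝ] F₁ ↦ A v) h2

lemma hasMFDerivAt_prodMk_space {f : M → F} {g : M → F₁} {x : M}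
    (hf : MDifferentiableAt 𝓘(ℝ, E) 𝓘(ℝ, F) f x) (hg : MDifferentiableAt 𝓘(ℝ, E) 𝓘(ℝ, F₁) g x) :
    HasMFDerivAt 𝓘(ℝ, E) 𝓘(ℝ, F × F₁) (fun y ↦ (f y, g y)) x
      ((mvfderiv 𝓘(ℝ, E) f x).prod (mvfderiv 𝓘(ℝ, E) g x)) :=
  ⟨hf.hasMFDerivAt.1.prodMk hg.hasMFDerivAt.1, hf.hasMFDerivAt.2.prodMk hg.hasMFDerivAt.2⟩

lemma mdifferentiableAt_bilin (β : F →L[ℝ] F₁ →L[ℝ] F₂) {f : M → F} {g : M → F₁} {x : M}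
    (hf : MDifferentiableAt 𝓘(ℝ, E) 𝓘(ℝ, F) f x) (hg : MDifferentiableAt 𝓘(ℝ, E) 𝓘(ℝ, F₁) g x) :
    MDifferentiableAt 𝓘(ℝ, E) 𝓘(ℝ, F₂) (fun y ↦ β (f y) (g y)) x := by
  have h1 : HasMFDerivAt 𝓘(ℝ, F × F₁) 𝓘(ℝ, F₂) (fun p : F × F₁ ↦ β p.1 p.2) (f x, g x) _ :=
    (β.isBoundedBilinearMap.hasFDerivAt (f x, g x)).hasMFDerivAt
  exact (HasMFDerivAt.comp x h1 (hasMFDerivAt_prodMk_space hf hg)).mdifferentiableAt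

lemma mvfderiv_bilin (β : F →L[ℝ] F₁ →L[ℝ] F₂) {f : M → F} {g : M → F₁} {x : M}
    (hf : MDifferentiableAt 𝓘(ℝ, E) 𝓘(ℝ, F) f x) (hg : MDifferentiableAt 𝓘(ℝ, E) 𝓘(ℝ, F₁) g x)
    (v : TangentSpace 𝓘(ℝ, E) x) :
    mvfderiv 𝓘(ℝ, E) (fun y ↦ β (f y) (g y)) x v =
      β (mvfderiv 𝓘(ℝ, E) f x v) (g x) + β (f x) (mvfderiv 𝓘(ℝ, E) g x v) := by
  have h1 : HasMFDerivAt 𝓘(ℝ, F × F₁) 𝓘(ℝ, F₂) (fun p : F × F₁ ↦ β p.1 p.2) (f x, g x) _ :=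
    (β.isBoundedBilinearMap.hasFDerivAt (f x, g x)).hasMFDerivAt
  have h2 := (HasMFDerivAt.comp x h1 (hasMFDerivAt_prodMk_space hf hg)).mfderiv
  refine (congrArg (fun A : E →L[ℝ] F₂ ↦ A v) h2).trans ?_
  exact add_comm _ _

lemma contMDiffAt_bilin {n : ℕ∞ω} (β : F →L[ℝ] F₁ →L[ℝ] F₂) {f : M → F} {g : M → F₁} {x : M}
    (hf : ContMDiffAt 𝓘(ℝ, E) 𝓘(ℝ, F) n f x) (hg : ContMDiffAt 𝓘(ℝ, E) 𝓘(ℝ, F₁) n g x) :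
    ContMDiffAt 𝓘(ℝ, E) 𝓘(ℝ, F₂) n (fun y ↦ β (f y) (g y)) x := by
  have h : ContDiff ℝ n (fun p : F × F₁ ↦ β p.1 p.2) := β.isBoundedBilinearMap.contDiff
  exact h.contMDiff.contMDiffAt.comp x (hf.prodMk_space hg)

variable [IsManifold 𝓘(ℝ, E) ∞ M]

lemma contMDiffAt_mvfderiv_apply {f : M → F} {X : ∀ y : M, TangentSpace 𝓘(ℝ, E) y} {x : M}
    (hf : ContMDiffAt 𝓘(ℝ, E) 𝓘(ℝ, F) ∞ f x) (hX : CMDiffAt ∞ (T% X) x) :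
    ContMDiffAt 𝓘(ℝ, E) 𝓘(ℝ, F) ∞ (fun y ↦ mvfderiv 𝓘(ℝ, E) f y (X y)) x := by
  have h1 := hf.mfderiv_const (m := ∞) le_rfl
  have h2 := ContMDiffAt.clm_apply_of_inCoordinates (b₁ := id) (b₂ := f) (v := X)
    (E₁ := TangentSpace 𝓘(ℝ, E)) (E₂ := TangentSpace 𝓘(ℝ, F)) h1 hX hf
  exact (contMDiff_snd_tangentBundle_modelSpace F 𝓘(ℝ, F)).contMDiffAt.comp x h2

lemma eventually_mdifferentiableAt {f : M → F} {x : M}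
    (hf : ContMDiffAt 𝓘(ℝ, E) 𝓘(ℝ, F) ∞ f x) :
    ∀ᶠ y in 𝓝 x, MDifferentiableAt 𝓘(ℝ, E) 𝓘(ℝ, F) f y := by
  have h1 : ContMDiffAt 𝓘(ℝ, E) 𝓘(ℝ, F) 1 f x := hf.of_le ENat.LEInfty.out
  filter_upwards [(contMDiffAt_iff_contMDiffAt_nhds (by simp)).1 h1] with y hy
  exact hy.mdifferentiableAt one_ne_zero

lemma eventually_mdifferentiableAt_section {X : ∀ y : M, TangentSpace 𝓘(ℝ, E) y} {x : M}
    (hX : CMDiffAt ∞ (T% X) x) : ∀ᶠ y in 𝓝 x, MDiffAt (T% X) y := by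
  have h1 : CMDiffAt 1 (T% X) x := hX.of_le ENat.LEInfty.out
  filter_upwards [(contMDiffAt_iff_contMDiffAt_nhds (by simp)).1 h1] with y hy
  exact hy.mdifferentiableAt one_ne_zero

lemma isManifold_minSmoothness (n : ℕ∞ω) [ENat.LEInfty n] :
    IsManifold 𝓘(ℝ, E) (minSmoothness ℝ n) M := by
  rw [minSmoothness_of_isRCLikeNormedField]
  infer_instance

variable [CompleteSpace E]

/-- Two applications of the Leibniz rule. The coefficient of Z contains X(Yf), which is how second
derivatives of f enter the Jacobi identity below. -/
lemma mlieBracket_mlieBracket_smul {X Y Z : ∀ y : M, TangentSpace 𝓘(ℝ, E) y} {f : M → ℝ} {x : M}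
    (hf : ContMDiffAt 𝓘(ℝ, E) 𝓘(ℝ, ℝ) ∞ f x) (hY : CMDiffAt ∞ (T% Y) x)
    (hZ : CMDiffAt ∞ (T% Z) x) :
    VectorField.mlieBracket 𝓘(ℝ, E) X (VectorField.mlieBracket 𝓘(ℝ, E) Y (f • Z)) x =
      mvfderiv 𝓘(ℝ, E) (fun y ↦ mvfderiv 𝓘(ℝ, E) f y (Y y)) x (X x) • Z x +
      mvfderiv 𝓘(ℝ, E) f x (Y x) • VectorField.mlieBracket 𝓘(ℝ, E) X Z x +
      (mvfderiv 𝓘(ℝ, E) f x (X x) • VectorField.mlieBracket 𝓘(ℝ, E) Y Z x +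
      f x • VectorField.mlieBracket 𝓘(ℝ, E) X (VectorField.mlieBracket 𝓘(ℝ, E) Y Z) x) := by
  have : IsManifold 𝓘(ℝ, E) (minSmoothness ℝ 2) M := isManifold_minSmoothness 2
  have hYZ : CMDiffAt 1 (T% (VectorField.mlieBracket 𝓘(ℝ, E) Y Z)) x :=
    have : IsManifold 𝓘(ℝ, E) (((2 : ℕ∞) : ℕ∞ω) + 1) M :=
      IsManifold.of_le (n := ∞) (by exact_mod_cast le_top)
    ContMDiffAt.mlieBracket_vectorField (m := 1) (n := 2) (hY.of_le ENat.LEInfty.out)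
      (hZ.of_le ENat.LEInfty.out) (by simp [one_add_one_eq_two])
  have hfY := contMDiffAt_mvfderiv_apply hf hY
  have ev : VectorField.mlieBracket 𝓘(ℝ, E) Y (f • Z) =ᶠ[𝓝 x]
      (fun y ↦ mvfderiv 𝓘(ℝ, E) f y (Y y)) • Z + f • VectorField.mlieBracket 𝓘(ℝ, E) Y Z := by
    filter_upwards [eventually_mdifferentiableAt hf, eventually_mdifferentiableAt_section hZ]
      with y h1 h2
    exact VectorField.mlieBracket_smul_right h1 h2
  have dZ := hZ.mdifferentiableAt (by simp)
  have dYZ := hYZ.mdifferentiableAt (by simp)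
  have df := hf.mdifferentiableAt (by simp)
  have dfY := hfY.mdifferentiableAt (by simp)
  rw [Filter.EventuallyEq.mlieBracket_vectorField_eq (Filter.EventuallyEq.refl _ X) ev,
    VectorField.mlieBracket_add_right (dfY.smul_section dZ) (df.smul_section dYZ),
    VectorField.mlieBracket_smul_right dfY dZ, VectorField.mlieBracket_smul_right df dYZ]

/-- `X (Y f) - Y (X f) = [X, Y] f`. -/
lemma mvfderiv_mlieBracket_real {X Y : ∀ y : M, TangentSpace 𝓘(ℝ, E) y} {f : M → ℝ} {x : M}
    (hf : ContMDiffAt 𝓘(ℝ, E) 𝓘(ℝ, ℝ) ∞ f x) (hX : CMDiffAt ∞ (T% X) x)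
    (hY : CMDiffAt ∞ (T% Y) x) :
    mvfderiv 𝓘(ℝ, E) (fun y ↦ mvfderiv 𝓘(ℝ, E) f y (Y y)) x (X x) -
      mvfderiv 𝓘(ℝ, E) (fun y ↦ mvfderiv 𝓘(ℝ, E) f y (X y)) x (Y x) =
      mvfderiv 𝓘(ℝ, E) f x (VectorField.mlieBracket 𝓘(ℝ, E) X Y x) := by
  rcases subsingleton_or_nontrivial E with hE | hE
  · have : Subsingleton (TangentSpace 𝓘(ℝ, E) x) := hE
    rw [Subsingleton.elim (X x) 0, Subsingleton.elim (Y x) 0,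
      Subsingleton.elim (VectorField.mlieBracket 𝓘(ℝ, E) X Y x) 0]
    simp
  have : Nontrivial (TangentSpace 𝓘(ℝ, E) x) := hE
  -- The Jacobi identity for X, Y, fZ minus f times the one for X, Y, Z leaves (X(Yf) - Y(Xf) -
  -- [X,Y]f) Z = 0 at x. A field Z with a nonzero value at x makes the coefficient vanish.
  obtain ⟨v, hv⟩ := exists_ne (0 : TangentSpace 𝓘(ℝ, E) x)
  set Z := FiberBundle.extend E v with hZdef
  have hZ : CMDiffAt ∞ (T% Z) x := FiberBundle.contMDiffAt_extend ..
  have hZx : Z x = v := by simp [hZdef]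
  have hfZ : CMDiffAt ∞ (T% (f • Z)) x := hf.smul_section hZ
  have le : minSmoothness ℝ 2 ≤ (∞ : ℕ∞ω) := by simp [ENat.LEInfty.out]
  have : IsManifold 𝓘(ℝ, E) (minSmoothness ℝ 3) M := isManifold_minSmoothness 3
  have : IsManifold 𝓘(ℝ, E) (minSmoothness ℝ 2) M := isManifold_minSmoothness 2
  have J1 := VectorField.leibniz_identity_mlieBracket_apply (hX.of_le le) (hY.of_le le)
    (hfZ.of_le le)
  have J2 := VectorField.leibniz_identity_mlieBracket_apply (hX.of_le le) (hY.of_le le)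
    (hZ.of_le le)
  rw [mlieBracket_mlieBracket_smul hf hY hZ, mlieBracket_mlieBracket_smul hf hX hZ,
    VectorField.mlieBracket_smul_right (hf.mdifferentiableAt (by simp))
    (hZ.mdifferentiableAt (by simp)), J2, hZx] at J1
  have key : (mvfderiv 𝓘(ℝ, E) (fun y ↦ mvfderiv 𝓘(ℝ, E) f y (Y y)) x (X x) -
      mvfderiv 𝓘(ℝ, E) (fun y ↦ mvfderiv 𝓘(ℝ, E) f y (X y)) x (Y x) -
      mvfderiv 𝓘(ℝ, E) f x (VectorField.mlieBracket 𝓘(ℝ, E) X Y x)) • v = 0 := by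
    rw [← sub_eq_zero] at J1
    rw [← J1]
    module
  exact sub_eq_zero.mp ((smul_eq_zero.mp key).resolve_right hv)

/-- `X (Y h) - Y (X h) = [X, Y] h` for vector valued functions `h`. -/
lemma mvfderiv_mlieBracket {X Y : ∀ y : M, TangentSpace 𝓘(ℝ, E) y} {h : M → F} {x : M}
    (hh : ContMDiffAt 𝓘(ℝ, E) 𝓘(ℝ, F) ∞ h x) (hX : CMDiffAt ∞ (T% X) x)
    (hY : CMDiffAt ∞ (T% Y) x) :
    mvfderiv 𝓘(ℝ, E) (fun y ↦ mvfderiv 𝓘(ℝ, E) h y (Y y)) x (X x) -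
      mvfderiv 𝓘(ℝ, E) (fun y ↦ mvfderiv 𝓘(ℝ, E) h y (X y)) x (Y x) =
      mvfderiv 𝓘(ℝ, E) h x (VectorField.mlieBracket 𝓘(ℝ, E) X Y x) := by
  -- Continuous functionals separate points, which reduces the claim to real valued functions.
  refine (SeparatingDual.eq_iff_forall_dual_eq (R := ℝ)).2 fun ℓ ↦ ?_
  have hℓ : ContMDiffAt 𝓘(ℝ, E) 𝓘(ℝ, ℝ) ∞ (fun y ↦ ℓ (h y)) x :=
    ℓ.contMDiff.contMDiffAt.comp x hh
  have comm : ∀ Z : ∀ y : M, TangentSpace 𝓘(ℝ, E) y, CMDiffAt ∞ (T% Z) x →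
      ∀ v : TangentSpace 𝓘(ℝ, E) x,
      mvfderiv 𝓘(ℝ, E) (fun y ↦ mvfderiv 𝓘(ℝ, E) (fun y ↦ ℓ (h y)) y (Z y)) x v =
        ℓ (mvfderiv 𝓘(ℝ, E) (fun y ↦ mvfderiv 𝓘(ℝ, E) h y (Z y)) x v) := by
    intro Z hZ v
    rw [← mvfderiv_clm_comp ℓ ((contMDiffAt_mvfderiv_apply hh hZ).mdifferentiableAt (by simp))]
    refine congrArg (fun A : TangentSpace 𝓘(ℝ, E) x →L[ℝ] ℝ ↦ A v) (mvfderiv_congr ?_)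
    filter_upwards [eventually_mdifferentiableAt hh] with y hy
    exact mvfderiv_clm_comp ℓ hy _
  rw [map_sub, ← comm Y hY, ← comm X hX, mvfderiv_mlieBracket_real hℓ hX hY,
    mvfderiv_clm_comp ℓ (hh.mdifferentiableAt (by simp))]

end Calculus

/-! ### Manifolds parallelized by a Lie algebra of vector fields -/

/-- A parallelism of `M` whose constant vector fields are closed under the Lie bracket: a smooth
field of linear isomorphisms `coframe x : T_x M ≃ E` such that the bracket of the vector fields
with constant components `a` and `b` has the constant component `bracket a b`. -/
structure Parallelism (E : Type*) [NormedAddCommGroup E] [NormedSpace ℝ E]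
    (M : Type*) [TopologicalSpace M] [ChartedSpace E M] [IsManifold 𝓘(ℝ, E) ∞ M] where
  coframe : ∀ x : M, TangentSpace 𝓘(ℝ, E) x ≃L[ℝ] E
  contMDiffAt_coframe : ∀ {X : ∀ y : M, TangentSpace 𝓘(ℝ, E) y} {x : M},
    CMDiffAt ∞ (T% X) x → ContMDiffAt 𝓘(ℝ, E) 𝓘(ℝ, E) ∞ (fun y ↦ coframe y (X y)) x
  contMDiffAt_frame : ∀ {f : M → E} {x : M}, ContMDiffAt 𝓘(ℝ, E) 𝓘(ℝ, E) ∞ f x →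
    CMDiffAt ∞ (T% (fun y ↦ (coframe y).symm (f y))) x
  mdifferentiableAt_coframe : ∀ {X : ∀ y : M, TangentSpace 𝓘(ℝ, E) y} {x : M},
    MDiffAt (T% X) x → MDifferentiableAt 𝓘(ℝ, E) 𝓘(ℝ, E) (fun y ↦ coframe y (X y)) x
  mdifferentiableAt_frame : ∀ {f : M → E} {x : M}, MDifferentiableAt 𝓘(ℝ, E) 𝓘(ℝ, E) f x →
    MDiffAt (T% (fun y ↦ (coframe y).symm (f y))) x
  bracket : E →L[ℝ] E →L[ℝ] E
  coframe_mlieBracket : ∀ (a b : E) (x : M),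
    coframe x (VectorField.mlieBracket 𝓘(ℝ, E) (fun y ↦ (coframe y).symm a)
      (fun y ↦ (coframe y).symm b) x) = bracket a b

/-- The bracket with a vector field, in terms of a trivialization of the tangent bundle. -/
lemma mlieBracket_eq_of_coframe {E : Type*} [NormedAddCommGroup E] [NormedSpace ℝ E]
    [FiniteDimensional ℝ E] [CompleteSpace E]
    {M : Type*} [TopologicalSpace M] [ChartedSpace E M] [IsManifold 𝓘(ℝ, E) ∞ M]
    (θ : ∀ x : M, TangentSpace 𝓘(ℝ, E) x ≃L[ℝ] E)
    (hθ : ∀ {X : ∀ y : M, TangentSpace 𝓘(ℝ, E) y} {x : M},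
      MDiffAt (T% X) x → MDifferentiableAt 𝓘(ℝ, E) 𝓘(ℝ, E) (fun y ↦ θ y (X y)) x)
    (hθ' : ∀ {f : M → E} {x : M}, MDifferentiableAt 𝓘(ℝ, E) 𝓘(ℝ, E) f x →
      MDiffAt (T% (fun y ↦ (θ y).symm (f y))) x)
    (X : ∀ y : M, TangentSpace 𝓘(ℝ, E) y) {V : ∀ y : M, TangentSpace 𝓘(ℝ, E) y} {x : M}
    (hV : MDiffAt (T% V) x) :
    θ x (VectorField.mlieBracket 𝓘(ℝ, E) X V x) =
      mvfderiv 𝓘(ℝ, E) (fun y ↦ θ y (V y)) x (X x) +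
        θ x (VectorField.mlieBracket 𝓘(ℝ, E) X (fun y ↦ (θ y).symm (θ x (V x))) x) := by
  -- The defect θ[X,V] - X(θV) is tensorial in V, as the terms in X(f) cancel. Hence V may be
  -- replaced by the field with constant components and the same value at x, for which X(θV) = 0.
  have tens : TensorialAt 𝓘(ℝ, E) E (fun V : ∀ y : M, TangentSpace 𝓘(ℝ, E) y ↦
      θ x (VectorField.mlieBracket 𝓘(ℝ, E) X V x) -
        mvfderiv 𝓘(ℝ, E) (fun y ↦ θ y (V y)) x (X x)) x := by
    constructor
    · intro f σ hf hσ
      have e : (fun y ↦ θ y ((f • σ) y)) = f • fun y ↦ θ y (σ y) := by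
        ext y
        simp
      simp only [VectorField.mlieBracket_smul_right hf hσ, map_add, map_smul]
      rw [e, mvfderiv_smul hf (hθ hσ)]
      simp only [add_apply, smul_apply, ContinuousLinearMap.smulRight_apply]
      module
    · intro σ σ' hσ hσ'
      have e : (fun y ↦ θ y ((σ + σ') y)) = (fun y ↦ θ y (σ y)) + fun y ↦ θ y (σ' y) := by
        ext y
        simp
      simp only [VectorField.mlieBracket_add_right hσ hσ', map_add]
      rw [e, mvfderiv_add (hθ hσ) (hθ hσ')]
      simp only [add_apply]
      abel
  have h := tens.pointwise hV (hθ' (f := fun _ ↦ θ x (V x)) mdifferentiableAt_const) (by simp)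
  have e : (fun y ↦ θ y ((θ y).symm (θ x (V x)))) = fun _ ↦ θ x (V x) := by
    ext y
    simp
  simp only [e, mvfderiv_const] at h
  rw [zero_apply, sub_zero] at h
  rw [← h]
  abel

namespace Parallelism

variable {E : Type*} [NormedAddCommGroup E] [NormedSpace ℝ E]
  {M : Type*} [TopologicalSpace M] [ChartedSpace E M] [IsManifold 𝓘(ℝ, E) ∞ M]
  (P : Parallelism E M)

lemma mvfderiv_coframe_frame (a : E) (x : M) :
    mvfderiv 𝓘(ℝ, E) (fun y ↦ P.coframe y ((P.coframe y).symm a)) x = 0 := by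
  have e : (fun y ↦ P.coframe y ((P.coframe y).symm a)) = fun _ ↦ a := by
    ext y
    simp
  rw [e, mvfderiv_const]

/-- The covariant derivative `∇_v Y` with components `dY(v) + [v, Y] / 2`. -/
def connection : AffineConnection E M where
  toFun Y x := (P.coframe x).symm.toContinuousLinearMap ∘L
    (mvfderiv 𝓘(ℝ, E) (fun y ↦ P.coframe y (Y y)) x +
      (1 / 2 : ℝ) • (P.bracket.flip (P.coframe x (Y x)) ∘L (P.coframe x).toContinuousLinearMap))
  isCovariantDerivativeOnUniv := by
    constructor
    · intro σ σ' x hσ hσ' _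
      have e : (fun y ↦ P.coframe y ((σ + σ') y)) =
          (fun y ↦ P.coframe y (σ y)) + fun y ↦ P.coframe y (σ' y) := by
        ext y
        simp
      rw [e, mvfderiv_add (P.mdifferentiableAt_coframe hσ) (P.mdifferentiableAt_coframe hσ')]
      ext v
      apply (P.coframe x).injective
      simp
      module
    · intro σ f x hσ hf _
      have e : (fun y ↦ P.coframe y ((f • σ) y)) = f • fun y ↦ P.coframe y (σ y) := by
        ext y
        simp
      rw [e, mvfderiv_smul hf (P.mdifferentiableAt_coframe hσ)]
      ext v
      apply (P.coframe x).injective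
      simp
      module

lemma coframe_connection (Y : ∀ y : M, TangentSpace 𝓘(ℝ, E) y) (x : M)
    (v : TangentSpace 𝓘(ℝ, E) x) :
    P.coframe x (P.connection Y x v) = mvfderiv 𝓘(ℝ, E) (fun y ↦ P.coframe y (Y y)) x v +
      (1 / 2 : ℝ) • P.bracket (P.coframe x v) (P.coframe x (Y x)) := by
  simp [connection]

lemma contMDiffAt_coframe_connection {X Y : ∀ y : M, TangentSpace 𝓘(ℝ, E) y} {x : M}
    (hX : CMDiffAt ∞ (T% X) x) (hY : CMDiffAt ∞ (T% Y) x) :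
    ContMDiffAt 𝓘(ℝ, E) 𝓘(ℝ, E) ∞ (fun y ↦ P.coframe y (P.connection Y y (X y))) x := by
  simp only [coframe_connection]
  have h := contMDiffAt_bilin ((1 / 2 : ℝ) • P.bracket) (P.contMDiffAt_coframe hX)
    (P.contMDiffAt_coframe hY)
  exact (contMDiffAt_mvfderiv_apply (P.contMDiffAt_coframe hY) hX).add h

lemma contMDiffAt_connection {X Y : ∀ y : M, TangentSpace 𝓘(ℝ, E) y} {x : M}
    (hX : CMDiffAt ∞ (T% X) x) (hY : CMDiffAt ∞ (T% Y) x) :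
    CMDiffAt ∞ (T% (fun y ↦ P.connection Y y (X y))) x := by
  have h := P.contMDiffAt_frame (P.contMDiffAt_coframe_connection hX hY)
  simpa only [ContinuousLinearEquiv.symm_apply_apply] using h

variable [FiniteDimensional ℝ E] [CompleteSpace E]

/-- Expanding one argument at a time, with antisymmetry in between, leaves the bracket of two fields
with constant components. -/
lemma coframe_mlieBracket_of_mdifferentiableAt {X Y : ∀ y : M, TangentSpace 𝓘(ℝ, E) y} {x : M}
    (hX : MDiffAt (T% X) x) (hY : MDiffAt (T% Y) x) :
    P.coframe x (VectorField.mlieBracket 𝓘(ℝ, E) X Y x) =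
      mvfderiv 𝓘(ℝ, E) (fun y ↦ P.coframe y (Y y)) x (X x) -
        mvfderiv 𝓘(ℝ, E) (fun y ↦ P.coframe y (X y)) x (Y x) +
        P.bracket (P.coframe x (X x)) (P.coframe x (Y x)) := by
  have exp := fun X {V} {x} ↦ mlieBracket_eq_of_coframe P.coframe P.mdifferentiableAt_coframe
    P.mdifferentiableAt_frame X (V := V) (x := x)
  rw [exp X hY, VectorField.mlieBracket_swap_apply, map_neg, exp _ hX,
    VectorField.mlieBracket_swap_apply, map_neg, P.coframe_mlieBracket,
    ContinuousLinearEquiv.symm_apply_apply]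
  abel

/-- The derivative terms match those of [X,Y], and antisymmetry gives [X,Y]/2 - [Y,X]/2 = [X,Y].
This is what fixes the factor 1/2. -/
lemma torsion_connection : CovariantDerivative.torsion P.connection = 0 := by
  refine (CovariantDerivative.torsion_eq_zero_iff _).2 fun {X Y x} hX hY ↦ ?_
  have skew : ∀ a b : E, P.bracket b a = - P.bracket a b := by
    intro a b
    rw [← P.coframe_mlieBracket b a x, VectorField.mlieBracket_swap_apply, map_neg,
      P.coframe_mlieBracket]
  apply (P.coframe x).injective
  rw [map_sub, coframe_connection, coframe_connection,
    P.coframe_mlieBracket_of_mdifferentiableAt hX hY, skew (P.coframe x (X x)) (P.coframe x (Y x))]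
  module

/-- The curvature of the connection is `- [[X, Y], Z] / 4`. -/
lemma coframe_curvature_connection
    (jac : ∀ a b c : E, P.bracket a (P.bracket b c) =
      P.bracket (P.bracket a b) c + P.bracket b (P.bracket a c))
    {X Y Z : ∀ y : M, TangentSpace 𝓘(ℝ, E) y} {x : M}
    (hX : CMDiffAt ∞ (T% X) x) (hY : CMDiffAt ∞ (T% Y) x) (hZ : CMDiffAt ∞ (T% Z) x) :
    P.coframe x (curvature P.connection X Y Z x) = -(1 / 4 : ℝ) •
      P.bracket (P.bracket (P.coframe x (X x)) (P.coframe x (Y x))) (P.coframe x (Z x)) := by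
  have second : ∀ {Y : ∀ y : M, TangentSpace 𝓘(ℝ, E) y}, CMDiffAt ∞ (T% Y) x →
      ∀ v : TangentSpace 𝓘(ℝ, E) x,
      mvfderiv 𝓘(ℝ, E) (fun y ↦ P.coframe y (P.connection Z y (Y y))) x v =
        mvfderiv 𝓘(ℝ, E) (fun y ↦ mvfderiv 𝓘(ℝ, E) (fun y ↦ P.coframe y (Z y)) y (Y y)) x v +
        ((1 / 2 : ℝ) • P.bracket (mvfderiv 𝓘(ℝ, E) (fun y ↦ P.coframe y (Y y)) x v)
          (P.coframe x (Z x)) +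
        (1 / 2 : ℝ) • P.bracket (P.coframe x (Y x))
          (mvfderiv 𝓘(ℝ, E) (fun y ↦ P.coframe y (Z y)) x v)) := by
    intro Y hY v
    simp only [coframe_connection]
    have dY := P.mdifferentiableAt_coframe (hY.mdifferentiableAt (by simp))
    have dZ := P.mdifferentiableAt_coframe (hZ.mdifferentiableAt (by simp))
    have h1 := (contMDiffAt_mvfderiv_apply (P.contMDiffAt_coframe hZ) hY).mdifferentiableAt
      (n := ∞) (by simp)
    have h2 := mdifferentiableAt_bilin ((1 / 2 : ℝ) • P.bracket) dY dZ
    have h3 := mvfderiv_bilin ((1 / 2 : ℝ) • P.bracket) dY dZ v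
    refine (congrArg (fun A : TangentSpace 𝓘(ℝ, E) x →L[ℝ] E ↦ A v) (mvfderiv_add h1 h2)).trans ?_
    exact congrArg _ h3
  rw [curvature, map_sub, map_sub, coframe_connection, coframe_connection, coframe_connection,
    second hY, second hX, coframe_connection, coframe_connection,
    ← mvfderiv_mlieBracket (P.contMDiffAt_coframe hZ) hX hY,
    P.coframe_mlieBracket_of_mdifferentiableAt (hX.mdifferentiableAt (by simp)) (hY.mdifferentiableAt (by simp))]
  -- All derivatives of components cancel, those of second order by the commutator identity. What
  -- remains is [X,[Y,Z]]/4 - [Y,[X,Z]]/4 - [[X,Y],Z]/2, and Jacobi turns the first two terms into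
  -- [[X,Y],Z]/4.
  simp only [map_add, map_sub, map_smul, add_apply, sub_apply, jac (P.coframe x (X x))]
  module

end Parallelism

/-! ### Levi-Civita connections -/

section LeviCivita

variable {E : Type*} [NormedAddCommGroup E] [NormedSpace ℝ E] [FiniteDimensional ℝ E]
  [CompleteSpace E]
  {M : Type*} [TopologicalSpace M] [ChartedSpace E M] [IsManifold 𝓘(ℝ, E) ∞ M]

/-- Let D be the difference of the two connections. Vanishing torsion makes D_X Z symmetric in X and
Z, and metricity makes g(D_v X, Z) skew in X and Z. Alternating the two symmetries around three
fields yields g(D_U Y, W) = -g(D_U Y, W). -/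
lemma IsLeviCivita.apply_eq {g : ∀ x : M, LinearMap.BilinForm ℝ (TangentSpace 𝓘(ℝ, E) x)}
    (hsymm : ∀ (x : M) (u v : TangentSpace 𝓘(ℝ, E) x), g x u v = g x v u)
    (hnd : ∀ (x : M) (u : TangentSpace 𝓘(ℝ, E) x), (∀ v, g x u v = 0) → u = 0)
    {cov cov' : AffineConnection E M} (h : IsLeviCivita g cov) (h' : IsLeviCivita g cov')
    {x : M} {Y : ∀ y : M, TangentSpace 𝓘(ℝ, E) y} (hY : MDiffAt (T% Y) x) :
    cov Y x = cov' Y x := by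
  have t := fun {X Y x} ↦ (CovariantDerivative.torsion_eq_zero_iff cov).1 h.1 (X := X) (Y := Y)
    (x := x)
  have t' := fun {X Y x} ↦ (CovariantDerivative.torsion_eq_zero_iff cov').1 h'.1 (X := X) (Y := Y)
    (x := x)
  have ext_mdiff : ∀ v : TangentSpace 𝓘(ℝ, E) x, MDiffAt (T% (FiberBundle.extend E v)) x :=
    fun v ↦ FiberBundle.mdifferentiableAt_extend ..
  have comm : ∀ {X Z : ∀ y : M, TangentSpace 𝓘(ℝ, E) y}, MDiffAt (T% X) x → MDiffAt (T% Z) x →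
      cov Z x (X x) - cov' Z x (X x) = cov X x (Z x) - cov' X x (Z x) := by
    intro X Z hX hZ
    have e1 := t hX hZ
    have e2 := t' hX hZ
    rw [← e2] at e1
    rw [sub_eq_sub_iff_sub_eq_sub]
    exact e1
  have skew : ∀ {X Z : ∀ y : M, TangentSpace 𝓘(ℝ, E) y}, MDiffAt (T% X) x → MDiffAt (T% Z) x →
      ∀ v, g x (cov X x v - cov' X x v) (Z x) = - g x (cov Z x v - cov' Z x v) (X x) := by
    intro X Z hX hZ v
    have e1 := h.2 x X Z hX hZ v
    have e2 := h'.2 x X Z hX hZ v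
    rw [e1] at e2
    rw [hsymm x (cov Z x v - cov' Z x v) (X x)]
    simp only [map_sub, LinearMap.sub_apply]
    linarith
  ext u
  rw [← sub_eq_zero]
  refine hnd x _ fun w ↦ ?_
  have hU := ext_mdiff u
  have hW := ext_mdiff w
  set U := FiberBundle.extend E u with hUd
  set W := FiberBundle.extend E w with hWd
  have hu : U x = u := by simp [hUd]
  have hw : W x = w := by simp [hWd]
  rw [← hu, ← hw]
  have c1 := skew hY hW (U x)
  have c2 := skew hU hY (W x)
  have c3 := skew hW hU (Y x)
  rw [comm hU hW] at c1
  rw [comm hW hY] at c2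
  rw [comm hY hU] at c3
  linarith

/-- The connections are only known to agree on differentiable fields. The curvature applies them to
∇_Y Z, so that field has to be shown differentiable before they can be exchanged. -/
lemma curvature_congr {cov cov' : AffineConnection E M} {x : M}
    (h : ∀ (y : M) (Y : ∀ y : M, TangentSpace 𝓘(ℝ, E) y), MDiffAt (T% Y) y → cov Y y = cov' Y y)
    (hs : ∀ X Y : ∀ y : M, TangentSpace 𝓘(ℝ, E) y, CMDiffAt ∞ (T% X) x → CMDiffAt ∞ (T% Y) x →
      MDiffAt (T% (fun y ↦ cov' Y y (X y))) x)
    {X Y Z : ∀ y : M, TangentSpace 𝓘(ℝ, E) y}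
    (hX : CMDiffAt ∞ (T% X) x) (hY : CMDiffAt ∞ (T% Y) x) (hZ : CMDiffAt ∞ (T% Z) x) :
    curvature cov X Y Z x = curvature cov' X Y Z x := by
  have key : ∀ Y : ∀ y : M, TangentSpace 𝓘(ℝ, E) y, CMDiffAt ∞ (T% Y) x →
      cov (fun y ↦ cov Z y (Y y)) x = cov' (fun y ↦ cov' Z y (Y y)) x := by
    intro Y hY
    have ev : ∀ᶠ y in 𝓝 x, cov' Z y (Y y) = cov Z y (Y y) := by
      filter_upwards [eventually_mdifferentiableAt_section hZ] with y hy
      rw [h y Z hy]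
    have d' := hs Y Z hY hZ
    have d : MDiffAt (T% (fun y ↦ cov Z y (Y y))) x := by
      refine d'.congr_of_eventuallyEq ?_
      filter_upwards [ev] with y hy
      rw [hy]
    rw [← h x _ d', cov.isCovariantDerivativeOnUniv.congr_of_eventuallyEq d' d Filter.univ_mem ev]
  rw [curvature, curvature, key Y hY, key X hX, h x Z (hZ.mdifferentiableAt (by simp))]

namespace Parallelism

variable (P : Parallelism E M)

/-- The connection preserves the tensors with constant components that are invariant under the
bracket. -/
lemma mvfderiv_bilin_connection {F : Type*} [NormedAddCommGroup F] [NormedSpace ℝ F]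
    {β : E →L[ℝ] E →L[ℝ] F}
    (hβ : ∀ a b c, β (P.bracket a b) c + β b (P.bracket a c) = 0)
    {x : M} {X Y : ∀ y : M, TangentSpace 𝓘(ℝ, E) y} (hX : MDiffAt (T% X) x)
    (hY : MDiffAt (T% Y) x) (v : TangentSpace 𝓘(ℝ, E) x) :
    mvfderiv 𝓘(ℝ, E) (fun y ↦ β (P.coframe y (X y)) (P.coframe y (Y y))) x v =
      β (P.coframe x (P.connection X x v)) (P.coframe x (Y x)) +
        β (P.coframe x (X x)) (P.coframe x (P.connection Y x v)) := by
  rw [mvfderiv_bilin β (P.mdifferentiableAt_coframe hX) (P.mdifferentiableAt_coframe hY),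
    coframe_connection, coframe_connection]
  have := hβ (P.coframe x v) (P.coframe x (X x)) (P.coframe x (Y x))
  simp only [map_add, map_smul, add_apply, smul_apply]
  rw [eq_neg_of_add_eq_zero_left this]
  module

lemma isLeviCivita_connection {g : ∀ x : M, LinearMap.BilinForm ℝ (TangentSpace 𝓘(ℝ, E) x)}
    {β : E →L[ℝ] E →L[ℝ] ℝ} (hβ : ∀ a b c, β (P.bracket a b) c + β b (P.bracket a c) = 0)
    (hg : ∀ x u v, g x u v = β (P.coframe x u) (P.coframe x v)) :
    IsLeviCivita g P.connection := by
  refine ⟨P.torsion_connection, fun x X Y hX hY v ↦ ?_⟩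
  simp only [hg]
  exact P.mvfderiv_bilin_connection hβ hX hY v

lemma coframe_curvatureAt
    (jac : ∀ a b c : E, P.bracket a (P.bracket b c) =
      P.bracket (P.bracket a b) c + P.bracket b (P.bracket a c))
    {cov : AffineConnection E M}
    (h : ∀ (y : M) (Y : ∀ y : M, TangentSpace 𝓘(ℝ, E) y), MDiffAt (T% Y) y →
      cov Y y = P.connection Y y) (x : M) (u v w : TangentSpace 𝓘(ℝ, E) x) :
    P.coframe x (curvatureAt cov x u v w) = -(1 / 4 : ℝ) •
      P.bracket (P.bracket (P.coframe x u) (P.coframe x v)) (P.coframe x w) := by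
  have sm : ∀ v : TangentSpace 𝓘(ℝ, E) x, CMDiffAt ∞ (T% (FiberBundle.extend E v)) x :=
    fun v ↦ FiberBundle.contMDiffAt_extend ..
  rw [curvatureAt, curvature_congr h (fun X Y hX hY ↦
    (P.contMDiffAt_connection hX hY).mdifferentiableAt (by simp)) (sm u) (sm v) (sm w),
    P.coframe_curvature_connection jac (sm u) (sm v) (sm w)]
  simp

end Parallelism

end LeviCivita

/-! ### Right-invariant trivialization of the tangent bundle of a Lie group -/

section LieGroup

variable {E : Type*} [NormedAddCommGroup E] [NormedSpace ℝ E]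
  {G : Type*} [TopologicalSpace G] [ChartedSpace E G] [Group G]

/-- The differential at `x` of the right translation by `a`. -/
def rightDiff (a x : G) : E →L[ℝ] E := mfderiv 𝓘(ℝ, E) 𝓘(ℝ, E) (fun w : G ↦ w * a) x

/-- The differential at `x` of the left translation by `a`. -/
def leftDiff (a x : G) : E →L[ℝ] E := mfderiv 𝓘(ℝ, E) 𝓘(ℝ, E) (fun w : G ↦ a * w) x

variable [LieGroup 𝓘(ℝ, E) ∞ G]

lemma hasMFDerivAt_mul_right (a x : G) :
    HasMFDerivAt 𝓘(ℝ, E) 𝓘(ℝ, E) (fun w : G ↦ w * a) x (rightDiff (E := E) a x) :=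
  ((contMDiff_mul_right (n := ∞) (I := 𝓘(ℝ, E)) (a := a)).mdifferentiableAt
    (by simp)).hasMFDerivAt

lemma hasMFDerivAt_mul_left (a x : G) :
    HasMFDerivAt 𝓘(ℝ, E) 𝓘(ℝ, E) (fun w : G ↦ a * w) x (leftDiff (E := E) a x) :=
  ((contMDiff_mul_left (n := ∞) (I := 𝓘(ℝ, E)) (a := a)).mdifferentiableAt
    (by simp)).hasMFDerivAt

lemma rightDiff_mul (a b x : G) :
    rightDiff (E := E) (a * b) x = rightDiff b (x * a) ∘L rightDiff a x := by
  have h := ((hasMFDerivAt_mul_right (E := E) b (x * a)).comp x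
    (hasMFDerivAt_mul_right (E := E) a x)).mfderiv
  have e : (fun w : G ↦ w * b) ∘ (fun w ↦ w * a) = fun w ↦ w * (a * b) := by
    ext w
    simp [mul_assoc]
  rw [e] at h
  exact h

lemma rightDiff_one (x : G) : rightDiff (E := E) 1 x = ContinuousLinearMap.id ℝ E := by
  have e : (fun w : G ↦ w * 1) = id := by
    ext w
    simp
  rw [rightDiff, e]
  exact mfderiv_id

/-- The differential at `z` of the right translation by `z⁻¹`, with values in `T_1 G`. -/
def rightCoframe (z : G) : TangentSpace 𝓘(ℝ, E) z ≃L[ℝ] E :=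
  ContinuousLinearEquiv.equivOfInverse (rightDiff (E := E) z⁻¹ z) (rightDiff (E := E) z 1)
    (fun v ↦ by
      have h := rightDiff_mul (E := E) z⁻¹ z z
      rw [inv_mul_cancel, rightDiff_one, mul_inv_cancel] at h
      exact (congrArg (fun A : E →L[ℝ] E ↦ A v) h).symm)
    (fun v ↦ by
      have h := rightDiff_mul (E := E) z z⁻¹ 1
      rw [mul_inv_cancel, rightDiff_one, one_mul] at h
      exact (congrArg (fun A : E →L[ℝ] E ↦ A v) h).symm)

lemma rightCoframe_apply (z : G) (v : TangentSpace 𝓘(ℝ, E) z) :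
    rightCoframe z v = rightDiff (E := E) z⁻¹ z v := rfl

lemma rightCoframe_symm_apply (z : G) (a : E) :
    (rightCoframe z).symm a = rightDiff (E := E) z 1 a := rfl

lemma mfderiv_mul_apply (z w : G) (u v : E) :
    mfderiv (𝓘(ℝ, E).prod 𝓘(ℝ, E)) 𝓘(ℝ, E) (fun p : G × G ↦ p.1 * p.2) (z, w) (u, v) =
      (rightDiff (E := E) w z u + leftDiff (E := E) z w v : E) :=
  mfderiv_prod_eq_add_apply ((contMDiff_mul 𝓘(ℝ, E) ∞).mdifferentiableAt (by simp))

/-- This is the tangent map of multiplication, on pairs of tangent vectors. Inserting a zero vector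
in one slot yields translations of vectors that are smooth jointly in the point and the vector,
hence smooth invariant frames and coframes. -/
lemma contMDiff_tangentMap_mul :
    ContMDiff (𝓘(ℝ, E).tangent.prod 𝓘(ℝ, E).tangent) 𝓘(ℝ, E).tangent ∞
      (fun p : TangentBundle 𝓘(ℝ, E) G × TangentBundle 𝓘(ℝ, E) G ↦
        (⟨p.1.1 * p.2.1, (rightDiff (E := E) p.2.1 p.1.1 p.1.2 +
          leftDiff (E := E) p.1.1 p.2.1 p.2.2 : E)⟩ : TangentBundle 𝓘(ℝ, E) G)) := by
  have h := ((contMDiff_mul 𝓘(ℝ, E) ∞ (G := G)).contMDiff_tangentMap (m := ∞) le_rfl).comp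
    (contMDiff_equivTangentBundleProd_symm (I := 𝓘(ℝ, E)) (M := G) (I' := 𝓘(ℝ, E)) (M' := G)
      (n := ∞))
  refine h.congr fun p ↦ ?_
  exact congrArg (Bundle.TotalSpace.mk' E (E := (TangentSpace 𝓘(ℝ, E) : G → Type _))
    (p.1.1 * p.2.1)) 
    (mfderiv_mul_apply (E := E) p.1.1 p.2.1 p.1.2 p.2.2).symm

lemma tangentBundle_mk_congr {x y : G} (h : x = y) (v : E) :
    (⟨x, v⟩ : TangentBundle 𝓘(ℝ, E) G) = ⟨y, v⟩ := by
  subst h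
  rfl

section Fiber

variable {E' H' : Type*} [NormedAddCommGroup E'] [NormedSpace ℝ E'] [TopologicalSpace H']
  {I' : ModelWithCorners ℝ E' H'} {N : Type*} [TopologicalSpace N] [ChartedSpace H' N]

/-- On one fibre the trivialization is a fixed linear isomorphism. This passes between curves of
vectors in `TangentBundle` over a fixed point and maps into the model space. -/
lemma contMDiff_mk_iff (z : G) {f : N → E} :
    ContMDiff I' 𝓘(ℝ, E).tangent ∞ (fun y ↦ (⟨z, f y⟩ : TangentBundle 𝓘(ℝ, E) G)) ↔
      ContMDiff I' 𝓘(ℝ, E) ∞ f := by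
  let A : E ≃L[ℝ] E := (trivializationAt E (TangentSpace 𝓘(ℝ, E)) z).continuousLinearEquivAt ℝ z
    (FiberBundle.mem_baseSet_trivializationAt' z)
  have hA : ∀ v : E, (trivializationAt E (TangentSpace 𝓘(ℝ, E)) z
      (⟨z, v⟩ : TangentBundle 𝓘(ℝ, E) G)).2 = A v := fun v ↦ rfl
  constructor
  · intro h x
    have h1 := (Bundle.contMDiffAt_totalSpace.1 (h x)).2
    simp only [hA] at h1
    have h2 := (A.symm : E →L[ℝ] E).contMDiff (n := ∞) |>.contMDiffAt.comp x h1
    refine h2.congr_of_eventuallyEq (Filter.Eventually.of_forall fun y ↦ ?_)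
    exact (A.symm_apply_apply (f y)).symm
  · intro h x
    refine Bundle.contMDiffAt_totalSpace.2 ⟨contMDiffAt_const, ?_⟩
    simp only [hA]
    exact (A : E →L[ℝ] E).contMDiff.contMDiffAt.comp x (h x)

end Fiber

lemma contMDiff_rightCoframe :
    ContMDiff 𝓘(ℝ, E).tangent 𝓘(ℝ, E) ∞
      (fun p : TangentBundle 𝓘(ℝ, E) G ↦ rightCoframe p.1 p.2) := by
  rw [← contMDiff_mk_iff (1 : G)]
  have hz : ContMDiff 𝓘(ℝ, E) 𝓘(ℝ, E).tangent ∞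
      (fun z : G ↦ (⟨z, (0 : E)⟩ : TangentBundle 𝓘(ℝ, E) G)) :=
    Bundle.contMDiff_zeroSection ℝ (TangentSpace 𝓘(ℝ, E))
  have hi : ContMDiff 𝓘(ℝ, E).tangent 𝓘(ℝ, E) ∞
      (fun p : TangentBundle 𝓘(ℝ, E) G ↦ p.1⁻¹) :=
    (contMDiff_inv 𝓘(ℝ, E) ∞).comp (Bundle.contMDiff_proj (TangentSpace 𝓘(ℝ, E)))
  refine (contMDiff_tangentMap_mul.comp (contMDiff_id.prodMk (hz.comp hi))).congr fun p ↦ ?_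
  refine (tangentBundle_mk_congr (mul_inv_cancel p.1) _).symm.trans ?_
  simp [rightCoframe_apply]

lemma contMDiff_rightFrame :
    ContMDiff (𝓘(ℝ, E).prod 𝓘(ℝ, E)) 𝓘(ℝ, E).tangent ∞
      (fun p : G × E ↦ (⟨p.1, (rightCoframe p.1).symm p.2⟩ : TangentBundle 𝓘(ℝ, E) G)) := by
  have hz : ContMDiff 𝓘(ℝ, E) 𝓘(ℝ, E).tangent ∞
      (fun z : G ↦ (⟨z, (0 : E)⟩ : TangentBundle 𝓘(ℝ, E) G)) :=
    Bundle.contMDiff_zeroSection ℝ (TangentSpace 𝓘(ℝ, E))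
  have h1 : ContMDiff (𝓘(ℝ, E).prod 𝓘(ℝ, E)) 𝓘(ℝ, E).tangent ∞
      (fun p : G × E ↦ (⟨1, p.2⟩ : TangentBundle 𝓘(ℝ, E) G)) :=
    (contMDiff_mk_iff (1 : G)).2 contMDiff_snd
  refine (contMDiff_tangentMap_mul.comp (h1.prodMk (hz.comp contMDiff_fst))).congr fun p ↦ ?_
  refine (tangentBundle_mk_congr (one_mul p.1) _).symm.trans ?_
  simp [rightCoframe_symm_apply]

end LieGroup

/-! ### Brackets of invariant vector fields -/

section Bracket

variable {E : Type*} [NormedAddCommGroup E] [NormedSpace ℝ E]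
  {F F₁ : Type*} [NormedAddCommGroup F] [NormedSpace ℝ F]
  [NormedAddCommGroup F₁] [NormedSpace ℝ F₁]

lemma mvfderiv_comp_fderiv {M : Type*} [TopologicalSpace M] [ChartedSpace E M]
    {K : F → F₁} {h : M → F} {x : M} (hK : DifferentiableAt ℝ K (h x))
    (hh : MDifferentiableAt 𝓘(ℝ, E) 𝓘(ℝ, F) h x) (v : TangentSpace 𝓘(ℝ, E) x) :
    mvfderiv 𝓘(ℝ, E) (fun y ↦ K (h y)) x v = fderiv ℝ K (h x) (mvfderiv 𝓘(ℝ, E) h x v) := by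
  have h2 := (hK.hasFDerivAt.hasMFDerivAt.comp x hh.hasMFDerivAt).mfderiv
  exact congrArg (fun A : E →L[ℝ] F₁ ↦ A v) h2

variable {G : Type*} [TopologicalSpace G] [ChartedSpace E G] [Group G] [LieGroup 𝓘(ℝ, E) ∞ G]

/-- The multiplication read in the chart at the identity. -/
def chartMul (E : Type*) [NormedAddCommGroup E] [NormedSpace ℝ E]
    (G : Type*) [TopologicalSpace G] [ChartedSpace E G] [Group G] (p : E × E) : E :=
  extChartAt 𝓘(ℝ, E) (1 : G)
    ((extChartAt 𝓘(ℝ, E) (1 : G)).symm p.1 * (extChartAt 𝓘(ℝ, E) (1 : G)).symm p.2)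

lemma contDiffAt_chartMul :
    ContDiffAt ℝ ∞ (chartMul E G)
      (extChartAt 𝓘(ℝ, E) (1 : G) 1, extChartAt 𝓘(ℝ, E) (1 : G) 1) := by
  have hs : ContMDiffAt 𝓘(ℝ, E) 𝓘(ℝ, E) ∞ (extChartAt 𝓘(ℝ, E) (1 : G)).symm
      (extChartAt 𝓘(ℝ, E) (1 : G) 1) :=
    (contMDiffOn_extChartAt_symm (1 : G)).contMDiffAt (extChartAt_target_mem_nhds (1 : G))
  have h1 : ContMDiffAt 𝓘(ℝ, E × E) 𝓘(ℝ, E) ∞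
      (fun p : E × E ↦ (extChartAt 𝓘(ℝ, E) (1 : G)).symm p.1)
      (extChartAt 𝓘(ℝ, E) (1 : G) 1, extChartAt 𝓘(ℝ, E) (1 : G) 1) :=
    ContMDiffAt.comp (f := Prod.fst) (_, _) hs contDiff_fst.contMDiff.contMDiffAt
  have h2 : ContMDiffAt 𝓘(ℝ, E × E) 𝓘(ℝ, E) ∞
      (fun p : E × E ↦ (extChartAt 𝓘(ℝ, E) (1 : G)).symm p.2)
      (extChartAt 𝓘(ℝ, E) (1 : G) 1, extChartAt 𝓘(ℝ, E) (1 : G) 1) :=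
    ContMDiffAt.comp (f := Prod.snd) (_, _) hs contDiff_snd.contMDiff.contMDiffAt
  have h3 := h1.mul h2
  refine ContMDiffAt.contDiffAt (ContMDiffAt.comp (g := extChartAt 𝓘(ℝ, E) (1 : G)) _ ?_ h3)
  simp only [extChartAt_to_inv, mul_one]
  exact contMDiffAt_extChartAt

lemma chartMul_apply_eventually (y : G) (hy : y ∈ (extChartAt 𝓘(ℝ, E) (1 : G)).source) :
    ∀ᶠ w in 𝓝 (1 : G),
      chartMul E G (extChartAt 𝓘(ℝ, E) (1 : G) y, extChartAt 𝓘(ℝ, E) (1 : G) w) =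
        extChartAt 𝓘(ℝ, E) (1 : G) (y * w) ∧
      chartMul E G (extChartAt 𝓘(ℝ, E) (1 : G) w, extChartAt 𝓘(ℝ, E) (1 : G) y) =
        extChartAt 𝓘(ℝ, E) (1 : G) (w * y) := by
  filter_upwards [extChartAt_source_mem_nhds (I := 𝓘(ℝ, E)) (1 : G)] with w hw
  simp only [chartMul, (extChartAt 𝓘(ℝ, E) (1 : G)).left_inv hy,
    (extChartAt 𝓘(ℝ, E) (1 : G)).left_inv hw, and_self]

/-- Derivative of the chart along the left- and right-invariant vector fields. -/
lemma mvfderiv_extChartAt_invariant (b : E) :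
    ∀ᶠ y in 𝓝 (1 : G),
      mvfderiv 𝓘(ℝ, E) (extChartAt 𝓘(ℝ, E) (1 : G)) y (leftDiff (E := E) y 1 b) =
        fderiv ℝ (chartMul E G) (extChartAt 𝓘(ℝ, E) (1 : G) y, extChartAt 𝓘(ℝ, E) (1 : G) 1)
          (0, mvfderiv 𝓘(ℝ, E) (extChartAt 𝓘(ℝ, E) (1 : G)) 1 b) ∧
      mvfderiv 𝓘(ℝ, E) (extChartAt 𝓘(ℝ, E) (1 : G)) y (rightDiff (E := E) y 1 b) =
        fderiv ℝ (chartMul E G) (extChartAt 𝓘(ℝ, E) (1 : G) 1, extChartAt 𝓘(ℝ, E) (1 : G) y)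
          (mvfderiv 𝓘(ℝ, E) (extChartAt 𝓘(ℝ, E) (1 : G)) 1 b, 0) := by
  set φ := extChartAt 𝓘(ℝ, E) (1 : G) with hφ
  have sm : ContMDiffAt 𝓘(ℝ, E) 𝓘(ℝ, E) ∞ φ 1 := contMDiffAt_extChartAt
  have d1 := sm.mdifferentiableAt (by simp)
  have dF : ∀ᶠ p in 𝓝 (φ 1, φ 1), DifferentiableAt ℝ (chartMul E G) p := by
    filter_upwards [((contDiffAt_chartMul (E := E) (G := G)).of_le
      (m := 1) ENat.LEInfty.out).eventually (by simp)] with p hp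
    exact hp.differentiableAt one_ne_zero
  have t1 : Filter.Tendsto (fun y ↦ (φ y, φ 1)) (𝓝 (1 : G)) (𝓝 (φ 1, φ 1)) :=
    sm.continuousAt.prodMk_nhds continuousAt_const
  have t2 : Filter.Tendsto (fun y ↦ (φ 1, φ y)) (𝓝 (1 : G)) (𝓝 (φ 1, φ 1)) :=
    continuousAt_const.prodMk_nhds sm.continuousAt
  filter_upwards [eventually_mdifferentiableAt sm, t1.eventually dF, t2.eventually dF,
    extChartAt_source_mem_nhds (I := 𝓘(ℝ, E)) (1 : G)] with y hy hy1 hy2 hys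
  constructor
  -- The function φ(yw) of w is differentiated at 1 in two ways: through the left translation by y,
  -- and through the multiplication read in the chart.
  · have e1 : mvfderiv 𝓘(ℝ, E) (fun w ↦ φ (y * w)) 1 b =
        mvfderiv 𝓘(ℝ, E) φ y (leftDiff (E := E) y 1 b) := by
      have h := ((mul_one y).symm ▸ hy : MDifferentiableAt 𝓘(ℝ, E) 𝓘(ℝ, E) φ (y * 1))
      have h2 := (h.hasMFDerivAt.comp 1 (hasMFDerivAt_mul_left (E := E) y 1)).mfderiv
      have h3 := congrArg (fun A : E →L[ℝ] E ↦ A b) h2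
      refine h3.trans ?_
      change (mfderiv 𝓘(ℝ, E) 𝓘(ℝ, E) φ (y * 1) : E →L[ℝ] E) _ =
        (mfderiv 𝓘(ℝ, E) 𝓘(ℝ, E) φ y : E →L[ℝ] E) _
      rw [mul_one]
      rfl
    rw [← e1, ← mvfderiv_congr ((chartMul_apply_eventually y hys).mono fun w hw ↦ hw.1)]
    have hp := hasMFDerivAt_prodMk_space (f := fun _ : G ↦ φ y) (x := 1)
      mdifferentiableAt_const d1
    have := mvfderiv_comp_fderiv (K := chartMul E G) (h := fun w ↦ (φ y, φ w)) hy1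
      hp.mdifferentiableAt b
    rw [this]
    congr 1
    refine (congrArg (fun A : E →L[ℝ] E × E ↦ A b) hp.mfderiv).trans ?_
    simp only [mvfderiv_const]
    rfl
  · have e1 : mvfderiv 𝓘(ℝ, E) (fun w ↦ φ (w * y)) 1 b =
        mvfderiv 𝓘(ℝ, E) φ y (rightDiff (E := E) y 1 b) := by
      have h := ((one_mul y).symm ▸ hy : MDifferentiableAt 𝓘(ℝ, E) 𝓘(ℝ, E) φ (1 * y))
      have h2 := (h.hasMFDerivAt.comp 1 (hasMFDerivAt_mul_right (E := E) y 1)).mfderiv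
      have h3 := congrArg (fun A : E →L[ℝ] E ↦ A b) h2
      refine h3.trans ?_
      change (mfderiv 𝓘(ℝ, E) 𝓘(ℝ, E) φ (1 * y) : E →L[ℝ] E) _ =
        (mfderiv 𝓘(ℝ, E) 𝓘(ℝ, E) φ y : E →L[ℝ] E) _
      rw [one_mul]
      rfl
    rw [← e1, ← mvfderiv_congr ((chartMul_apply_eventually y hys).mono fun w hw ↦ hw.2)]
    have hp := hasMFDerivAt_prodMk_space (g := fun _ : G ↦ φ y) (x := 1)
      d1 mdifferentiableAt_const
    have := mvfderiv_comp_fderiv (K := chartMul E G) (h := fun w ↦ (φ w, φ y)) hy2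
      hp.mdifferentiableAt b
    rw [this]
    congr 1
    refine (congrArg (fun A : E →L[ℝ] E × E ↦ A b) hp.mfderiv).trans ?_
    simp only [mvfderiv_const]
    rfl

end Bracket

section InvariantFields

variable {E : Type*} [NormedAddCommGroup E] [NormedSpace ℝ E]
  {G : Type*} [TopologicalSpace G] [ChartedSpace E G] [Group G]

/-- The right-invariant vector field with value `a` at the identity. -/
def rightField (a : E) (z : G) : TangentSpace 𝓘(ℝ, E) z := rightDiff (E := E) z 1 a

/-- The left-invariant vector field with value `b` at the identity. -/
def leftField (b : E) (z : G) : TangentSpace 𝓘(ℝ, E) z := leftDiff (E := E) z 1 b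

variable [LieGroup 𝓘(ℝ, E) ∞ G]

lemma contMDiff_rightField (a : E) : CMDiff ∞ (T% (rightField (G := G) a)) :=
  contMDiff_rightFrame.comp (contMDiff_id.prodMk contMDiff_const)

lemma contMDiff_leftField (b : E) : CMDiff ∞ (T% (leftField (G := G) b)) := by
  have hz : ContMDiff 𝓘(ℝ, E) 𝓘(ℝ, E).tangent ∞
      (fun z : G ↦ (⟨z, (0 : E)⟩ : TangentBundle 𝓘(ℝ, E) G)) :=
    Bundle.contMDiff_zeroSection ℝ (TangentSpace 𝓘(ℝ, E))
  have h1 : ContMDiff 𝓘(ℝ, E) 𝓘(ℝ, E).tangent ∞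
      (fun _ : G ↦ (⟨1, b⟩ : TangentBundle 𝓘(ℝ, E) G)) := contMDiff_const
  refine (contMDiff_tangentMap_mul.comp (hz.prodMk h1)).congr fun p ↦ ?_
  refine (tangentBundle_mk_congr (mul_one p) _).symm.trans ?_
  simp [leftField]

lemma leftDiff_one (x : G) : leftDiff (E := E) 1 x = ContinuousLinearMap.id ℝ E := by
  have e : (fun w : G ↦ 1 * w) = id := by
    ext w
    simp
  rw [leftDiff, e]
  exact mfderiv_id

lemma rightCoframe_one (v : TangentSpace 𝓘(ℝ, E) (1 : G)) : rightCoframe (1 : G) v = v := by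
  rw [rightCoframe_apply, inv_one, rightDiff_one]
  rfl

variable [CompleteSpace E]

/-- Left- and right-invariant vector fields commute. -/
lemma mlieBracket_rightField_leftField (a b : E) :
    VectorField.mlieBracket 𝓘(ℝ, E) (rightField a) (leftField b) (1 : G) = 0 := by
  set φ := extChartAt 𝓘(ℝ, E) (1 : G) with hφ
  have sm : ContMDiffAt 𝓘(ℝ, E) 𝓘(ℝ, E) ∞ φ 1 := contMDiffAt_extChartAt
  have d1 := sm.mdifferentiableAt (by simp)
  have hra : rightField a (1 : G) = a := by rw [rightField, rightDiff_one]; rfl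
  have hlb : leftField b (1 : G) = b := by rw [leftField, leftDiff_one]; rfl
  -- The bracket is tested on the chart φ, whose differential is injective. Both iterated
  -- derivatives turn out to be the mixed second derivative of the multiplication at (φ 1, φ 1), in
  -- the directions (a,0) and (0,b) taken in either order, so they agree.
  have key := mvfderiv_mlieBracket sm (contMDiff_rightField a 1) (contMDiff_leftField b 1)
  have dF : DifferentiableAt ℝ (fderiv ℝ (chartMul E G)) (φ 1, φ 1) := by
    have h := (contDiffAt_chartMul (E := E) (G := G)).fderiv_right (m := 1)
      (by simp [one_add_one_eq_two, ENat.LEInfty.out])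
    exact h.differentiableAt one_ne_zero
  have hF : DifferentiableAt ℝ (fun p ↦ fderiv ℝ (chartMul E G) p) (φ 1, φ 1) := dF
  have sndL : ∀ v : TangentSpace 𝓘(ℝ, E) (1 : G),
      mvfderiv 𝓘(ℝ, E) (fun y ↦ mvfderiv 𝓘(ℝ, E) φ y (leftField b y)) 1 v =
        fderiv ℝ (fderiv ℝ (chartMul E G)) (φ 1, φ 1) (mvfderiv 𝓘(ℝ, E) φ 1 v, 0)
          (0, mvfderiv 𝓘(ℝ, E) φ 1 b) := by
    intro v
    have hp := hasMFDerivAt_prodMk_space (g := fun _ : G ↦ φ 1) (x := 1) d1 mdifferentiableAt_const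
    refine (congrArg (fun A : E →L[ℝ] E ↦ A v)
      (mvfderiv_congr ((mvfderiv_extChartAt_invariant b).mono fun y hy ↦ hy.1))).trans ?_
    have h1 := mvfderiv_comp_fderiv (E := E) (M := G)
      (K := fun p ↦ fderiv ℝ (chartMul E G) p (0, mvfderiv 𝓘(ℝ, E) φ 1 b))
      (h := fun y ↦ (φ y, φ 1)) (hF.clm_apply (differentiableAt_const _)) hp.mdifferentiableAt v
    refine h1.trans ?_
    rw [fderiv_clm_apply hF (differentiableAt_const _)]
    have h2 : mvfderiv 𝓘(ℝ, E) (fun y ↦ (φ y, φ 1)) 1 v = (mvfderiv 𝓘(ℝ, E) φ 1 v, 0) := by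
      refine (congrArg (fun A : E →L[ℝ] E × E ↦ A v) hp.mfderiv).trans ?_
      simp only [mvfderiv_const]
      rfl
    rw [h2]
    simp
  have sndR : ∀ v : TangentSpace 𝓘(ℝ, E) (1 : G),
      mvfderiv 𝓘(ℝ, E) (fun y ↦ mvfderiv 𝓘(ℝ, E) φ y (rightField a y)) 1 v =
        fderiv ℝ (fderiv ℝ (chartMul E G)) (φ 1, φ 1) (0, mvfderiv 𝓘(ℝ, E) φ 1 v)
          (mvfderiv 𝓘(ℝ, E) φ 1 a, 0) := by
    intro v
    have hp := hasMFDerivAt_prodMk_space (f := fun _ : G ↦ φ 1) (x := 1) mdifferentiableAt_const d1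
    refine (congrArg (fun A : E →L[ℝ] E ↦ A v)
      (mvfderiv_congr ((mvfderiv_extChartAt_invariant a).mono fun y hy ↦ hy.2))).trans ?_
    have h1 := mvfderiv_comp_fderiv (E := E) (M := G)
      (K := fun p ↦ fderiv ℝ (chartMul E G) p (mvfderiv 𝓘(ℝ, E) φ 1 a, 0))
      (h := fun y ↦ (φ 1, φ y)) (hF.clm_apply (differentiableAt_const _)) hp.mdifferentiableAt v
    refine h1.trans ?_
    rw [fderiv_clm_apply hF (differentiableAt_const _)]
    have h2 : mvfderiv 𝓘(ℝ, E) (fun y ↦ (φ 1, φ y)) 1 v = (0, mvfderiv 𝓘(ℝ, E) φ 1 v) := by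
      refine (congrArg (fun A : E →L[ℝ] E × E ↦ A v) hp.mfderiv).trans ?_
      simp only [mvfderiv_const]
      rfl
    rw [h2]
    simp
  have symm : IsSymmSndFDerivAt ℝ (chartMul E G) (φ 1, φ 1) :=
    (contDiffAt_chartMul (E := E) (G := G)).isSymmSndFDerivAt (by simp [ENat.LEInfty.out])
  rw [sndL, sndR, hra, hlb, symm.eq, sub_self] at key
  have inj := (isInvertible_mfderiv_extChartAt (I := 𝓘(ℝ, E))
    (mem_extChartAt_source (I := 𝓘(ℝ, E)) (1 : G))).injective
  refine inj (Eq.trans key.symm ?_)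
  rw [map_zero]
  rfl

end InvariantFields

/-! ### The adjoint representation and the parallelism by right-invariant fields -/

section RightParallelism

variable {E : Type*} [NormedAddCommGroup E] [NormedSpace ℝ E] [FiniteDimensional ℝ E]
  [CompleteSpace E]
  {G : Type*} [TopologicalSpace G] [ChartedSpace E G] [Group G] [LieGroup 𝓘(ℝ, E) ∞ G]

lemma lieGroup_minSmoothness : LieGroup 𝓘(ℝ, E) (minSmoothness ℝ 3) G := by
  rw [minSmoothness_of_isRCLikeNormedField]
  infer_instance

variable (E G) in
/-- The Lie bracket of the Lie algebra of `G`, as a continuous bilinear map. -/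
def groupBracket : E →L[ℝ] E →L[ℝ] E :=
  have : LieGroup 𝓘(ℝ, E) (minSmoothness ℝ 3) G := lieGroup_minSmoothness
  LinearMap.toContinuousBilinearMap <| LinearMap.mk₂ ℝ
    (fun a b : E ↦
      (VectorField.mlieBracket 𝓘(ℝ, E) (leftField a) (leftField b) (1 : G) : E))
    (fun a b c ↦ add_lie (L := GroupLieAlgebra 𝓘(ℝ, E) G) (M := GroupLieAlgebra 𝓘(ℝ, E) G) a b c)
    (fun r a b ↦ smul_lie (L := GroupLieAlgebra 𝓘(ℝ, E) G) (M := GroupLieAlgebra 𝓘(ℝ, E) G) r a b)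
    (fun a b c ↦ lie_add (L := GroupLieAlgebra 𝓘(ℝ, E) G) (M := GroupLieAlgebra 𝓘(ℝ, E) G) a b c)
    (fun r a b ↦ lie_smul (L := GroupLieAlgebra 𝓘(ℝ, E) G) (M := GroupLieAlgebra 𝓘(ℝ, E) G) r a b)

lemma groupBracket_leibniz (a b c : E) :
    groupBracket E G a (groupBracket E G b c) =
      groupBracket E G (groupBracket E G a b) c + groupBracket E G b (groupBracket E G a c) :=
  have : LieGroup 𝓘(ℝ, E) (minSmoothness ℝ 3) G := lieGroup_minSmoothness
  leibniz_lie (L₁ := GroupLieAlgebra 𝓘(ℝ, E) G) (L₂ := GroupLieAlgebra 𝓘(ℝ, E) G)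
    (M := GroupLieAlgebra 𝓘(ℝ, E) G) a b c

lemma mdifferentiableAt_rightCoframe {X : ∀ y : G, TangentSpace 𝓘(ℝ, E) y} {x : G}
    (hX : MDiffAt (T% X) x) :
    MDifferentiableAt 𝓘(ℝ, E) 𝓘(ℝ, E) (fun y ↦ rightCoframe y (X y)) x :=
  ((contMDiff_rightCoframe (E := E) (G := G)).mdifferentiableAt (by simp)).comp x hX

lemma mdifferentiableAt_rightFrame {f : G → E} {x : G}
    (hf : MDifferentiableAt 𝓘(ℝ, E) 𝓘(ℝ, E) f x) :
    MDiffAt (T% (fun y : G ↦ (rightCoframe (E := E) y).symm (f y))) x := by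
  have h : MDifferentiableAt 𝓘(ℝ, E) (𝓘(ℝ, E).prod 𝓘(ℝ, E)) (fun y ↦ (y, f y)) x :=
    mdifferentiableAt_id.prodMk hf
  exact MDifferentiableAt.comp x
    ((contMDiff_rightFrame (E := E) (G := G)).mdifferentiableAt (x := (x, f x)) (by simp)) h

/-- The adjoint representation `z ↦ Ad_z b`. -/
def adjoint (b : E) (z : G) : E := rightCoframe z (leftField b z)

lemma adjoint_one (b : E) : adjoint b (1 : G) = b := by
  rw [adjoint, rightCoframe_one, leftField, leftDiff_one]
  rfl

/-- Ad_z b is the component at z of the left-invariant field of b in the right-invariant frame.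
Expanding the bracket of the left-invariant fields of a and b in that frame, the term with a
right-invariant field vanishes because left- and right-invariant fields commute. -/
lemma mvfderiv_adjoint (a b : E) :
    mvfderiv 𝓘(ℝ, E) (adjoint (G := G) b) 1 a = groupBracket E G a b := by
  have h := mlieBracket_eq_of_coframe (rightCoframe (E := E) (G := G))
    mdifferentiableAt_rightCoframe mdifferentiableAt_rightFrame (leftField a)
    (V := leftField b) (x := 1) ((contMDiff_leftField b 1).mdifferentiableAt (by simp))
  have e : leftField a (1 : G) = a := by rw [leftField, leftDiff_one]; rfl
  have e' : VectorField.mlieBracket 𝓘(ℝ, E) (leftField a)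
      (fun y ↦ (rightCoframe y).symm (rightCoframe (1 : G) (leftField b 1))) (1 : G) = 0 := by
    have e2 : (fun y : G ↦ (rightCoframe y).symm (rightCoframe (1 : G) (leftField b 1))) =
        rightField b := by
      have e3 : rightCoframe (1 : G) (leftField b 1) = b := adjoint_one b
      rw [e3]
      rfl
    rw [e2, VectorField.mlieBracket_swap_apply, mlieBracket_rightField_leftField, neg_zero]
  rw [e', map_zero, add_zero, rightCoframe_one, e] at h
  exact h.symm

/-- The same expansion for the vanishing bracket of the right-invariant field of a with the
left-invariant field of b reads 0 = d(Ad b)(a) + [a^R, b^R], whence the sign. -/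
lemma mlieBracket_rightField_one (a b : E) :
    VectorField.mlieBracket 𝓘(ℝ, E) (rightField a) (rightField b) (1 : G) =
      (-groupBracket E G a b : E) := by
  have h := mlieBracket_eq_of_coframe (rightCoframe (E := E) (G := G))
    mdifferentiableAt_rightCoframe mdifferentiableAt_rightFrame (rightField a)
    (V := leftField b) (x := 1) ((contMDiff_leftField b 1).mdifferentiableAt (by simp))
  have e : rightField a (1 : G) = a := by rw [rightField, rightDiff_one]; rfl
  have e2 : (fun y : G ↦ (rightCoframe y).symm (rightCoframe (1 : G) (leftField b 1))) =
      rightField b := by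
    have e3 : rightCoframe (1 : G) (leftField b 1) = b := adjoint_one b
    rw [e3]
    rfl
  rw [mlieBracket_rightField_leftField, map_zero, e2, e, rightCoframe_one] at h
  have aux : ∀ {u v w : E}, 0 = u + v → u = w → v = -w := fun h h' ↦
    eq_neg_of_add_eq_zero_right (h' ▸ h.symm)
  exact aux h (mvfderiv_adjoint a b)

lemma rightDiff_rightField (w z : G) (a : E) :
    rightDiff (E := E) w z (rightField a z) = rightField a (z * w) := by
  have h := rightDiff_mul (E := E) z w (1 : G)
  rw [one_mul] at h
  exact (congrArg (fun A : E →L[ℝ] E ↦ A a) h).symm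

lemma inverse_rightDiff (w z : G) :
    (rightDiff (E := E) w z).inverse = rightDiff (E := E) w⁻¹ (z * w) := by
  refine ContinuousLinearMap.inverse_eq ?_ ?_
  · have h := rightDiff_mul (E := E) w⁻¹ w (z * w)
    rw [inv_mul_cancel, rightDiff_one, mul_inv_cancel_right] at h
    exact h.symm
  · have h := rightDiff_mul (E := E) w w⁻¹ z
    rw [mul_inv_cancel, rightDiff_one] at h
    exact h.symm

lemma mpullback_rightField (w : G) (a : E) :
    VectorField.mpullback 𝓘(ℝ, E) 𝓘(ℝ, E) (fun z : G ↦ z * w) (rightField a) = rightField a := by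
  ext z
  have h := rightDiff_rightField w⁻¹ (z * w) a
  rw [← inverse_rightDiff] at h
  refine Eq.trans h ?_
  exact congrArg (fun y : G ↦ (rightField a y : E)) (mul_inv_cancel_right z w)

/-- Pullback by a right translation preserves brackets and right-invariant fields, so the value at z
is carried to the one at the identity. -/
lemma rightCoframe_mlieBracket_rightField (a b : E) (z : G) :
    rightCoframe z (VectorField.mlieBracket 𝓘(ℝ, E) (rightField a) (rightField b) z) =
      -groupBracket E G a b := by
  have : IsManifold 𝓘(ℝ, E) (minSmoothness ℝ 2) G := isManifold_minSmoothness 2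
  have h := VectorField.mpullback_mlieBracket (I := 𝓘(ℝ, E)) (I' := 𝓘(ℝ, E)) (n := ∞)
    (f := fun y : G ↦ y * z⁻¹) (x₀ := z) (V := rightField a) (W := rightField b)
    ((contMDiff_rightField a _).mdifferentiableAt (by simp))
    ((contMDiff_rightField b _).mdifferentiableAt (by simp))
    (contMDiff_mul_right (n := ∞) (I := 𝓘(ℝ, E)) (a := z⁻¹)).contMDiffAt
    (by simp [ENat.LEInfty.out])
  rw [mpullback_rightField, mpullback_rightField] at h
  rw [← h, ← mlieBracket_rightField_one]
  have e : ∀ v : E, rightCoframe z ((rightDiff (E := E) z⁻¹ z).inverse v) = v := by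
    intro v
    have h2 : (rightDiff (E := E) z⁻¹ z).inverse = rightDiff (E := E) z 1 := by
      rw [inverse_rightDiff, inv_inv, mul_inv_cancel]
    rw [h2]
    exact (rightCoframe z).apply_symm_apply v
  refine (e _).trans ?_
  exact congrArg (fun y : G ↦
    (VectorField.mlieBracket 𝓘(ℝ, E) (rightField a) (rightField b) y : E)) (mul_inv_cancel z)

variable (E G) in
/-- The parallelism of a Lie group by its right-invariant vector fields. -/
def rightParallelism : Parallelism E G where
  coframe := rightCoframe
  contMDiffAt_coframe hX := (contMDiff_rightCoframe (E := E) (G := G)).contMDiffAt.comp _ hX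
  contMDiffAt_frame {f x} hf :=
    have h : ContMDiffAt 𝓘(ℝ, E) (𝓘(ℝ, E).prod 𝓘(ℝ, E)) ∞ (fun y ↦ (y, f y)) x :=
      contMDiffAt_id.prodMk hf
    ContMDiffAt.comp x ((contMDiff_rightFrame (E := E) (G := G)).contMDiffAt (x := (x, f x))) h
  mdifferentiableAt_coframe := mdifferentiableAt_rightCoframe
  mdifferentiableAt_frame := mdifferentiableAt_rightFrame
  -- The Lie algebra of G is defined by left-invariant fields, hence the sign. It disappears from
  -- the curvature, which is quadratic in the bracket.
  bracket := -groupBracket E G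
  coframe_mlieBracket a b x := rightCoframe_mlieBracket_rightField a b x

end RightParallelism

/-! ### Invariance of J and para-complex linearity of the Lie bracket -/

section ParaComplexGroup

variable {E : Type*} [NormedAddCommGroup E] [NormedSpace ℝ E] [FiniteDimensional ℝ E]
  [CompleteSpace E]
  {G : Type*} [TopologicalSpace G] [ChartedSpace E G] [Group G] [LieGroup 𝓘(ℝ, E) ∞ G]
  {J : ParaComplexStructure E G}

/-- The para-complex structure at `z`, as an endomorphism of the model space. -/
def structureAt (J : ParaComplexStructure E G) (z : G) : E →L[ℝ] E := J.toFun z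

/-- On vectors (v, 0) the differential of multiplication is that of a right translation. -/
lemma IsParaComplexLieGroup.rightDiff_structureAt (hJ : IsParaComplexLieGroup J) (z w : G) (v : E) :
    rightDiff (E := E) w z (structureAt J z v) =
      structureAt J (z * w) (rightDiff (E := E) w z v) := by
  have h := hJ.mul.2 (z, w) (v, (0 : E))
  have e : prodStructure J (z, w) (v, (0 : E)) = (structureAt J z v, (0 : E)) := by
    refine Prod.ext rfl ?_
    exact map_zero (J.toFun w)
  rw [e] at h
  have h1 : _ = (_ : E) := mfderiv_mul_apply z w (structureAt J z v) 0
  have h2 : _ = (_ : E) := mfderiv_mul_apply z w v (0 : E)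
  rw [map_zero, add_zero] at h1 h2
  exact h1.symm.trans (h.trans (congrArg (structureAt J (z * w)) h2))

lemma IsParaComplexLieGroup.leftDiff_structureAt (hJ : IsParaComplexLieGroup J) (z w : G) (v : E) :
    leftDiff (E := E) z w (structureAt J w v) =
      structureAt J (z * w) (leftDiff (E := E) z w v) := by
  have h := hJ.mul.2 (z, w) ((0 : E), v)
  have e : prodStructure J (z, w) ((0 : E), v) = ((0 : E), structureAt J w v) := by
    refine Prod.ext ?_ rfl
    exact map_zero (J.toFun z)
  rw [e] at h
  have h1 : _ = (_ : E) := mfderiv_mul_apply z w (0 : E) (structureAt J w v)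
  have h2 : _ = (_ : E) := mfderiv_mul_apply z w (0 : E) v
  rw [map_zero, zero_add] at h1 h2
  exact h1.symm.trans (h.trans (congrArg (structureAt J (z * w)) h2))

lemma IsParaComplexLieGroup.rightCoframe_apply (hJ : IsParaComplexLieGroup J) (z : G)
    (v : TangentSpace 𝓘(ℝ, E) z) :
    rightCoframe z (J.toFun z v) = structureAt J 1 (rightCoframe z v) := by
  refine (hJ.rightDiff_structureAt z z⁻¹ v).trans ?_
  rw [mul_inv_cancel]
  rfl

lemma IsParaComplexLieGroup.leftField_apply (hJ : IsParaComplexLieGroup J) (z : G) (b : E) :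
    leftField (structureAt J 1 b) z = J.toFun z (leftField b z) := by
  refine (hJ.leftDiff_structureAt z 1 b).trans ?_
  rw [mul_one]
  rfl

/-- The Lie bracket of a para-complex Lie group is para-complex bilinear. -/
lemma IsParaComplexLieGroup.groupBracket_structureAt (hJ : IsParaComplexLieGroup J) (a b : E) :
    groupBracket E G a (structureAt J 1 b) = structureAt J 1 (groupBracket E G a b) := by
  -- Left and right translations commute with J, so Ad_z commutes with J_1 for every z. Its
  -- derivative at 1 along a is ad a, which therefore commutes with J_1 too.
  have e : adjoint (G := G) (structureAt J 1 b) = fun z ↦ structureAt J 1 (adjoint b z) := by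
    ext z
    rw [adjoint, hJ.leftField_apply, hJ.rightCoframe_apply]
    rfl
  have hd : MDifferentiableAt 𝓘(ℝ, E) 𝓘(ℝ, E) (adjoint (G := G) b) 1 :=
    mdifferentiableAt_rightCoframe ((contMDiff_leftField b 1).mdifferentiableAt (by simp))
  rw [← mvfderiv_adjoint, ← mvfderiv_adjoint, e]
  exact mvfderiv_clm_comp _ hd a

end ParaComplexGroup

/-! ### The Killing form over the para-complex numbers -/

section Algebra

/-- In the real basis 1, e, multiplication by x + ey has both diagonal entries equal to x. Each
diagonal entry of the matrix of f over C thus contributes twice its real part. -/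
lemma trace_restrictScalars_paraComplex {L ι : Type*} [Fintype ι] [AddCommGroup L] [Module ℝ L]
    [Module ParaComplex L] [IsScalarTower ℝ ParaComplex L] (b : Module.Basis ι ParaComplex L)
    (f : L →ₗ[ParaComplex] L) :
    LinearMap.trace ℝ L (f.restrictScalars ℝ) = 2 * (LinearMap.trace ParaComplex L f).re := by
  classical
  have h : ∀ (i : Fin 2) (j : ι),
      ((QuadraticAlgebra.basis (1 : ℝ) 0).smulTower b).repr
        (f (((QuadraticAlgebra.basis (1 : ℝ) 0).smulTower b) (i, j))) (i, j) =
      (b.repr (f (b j)) j).re := by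
    intro i j
    rw [Module.Basis.smulTower_apply, map_smul, Module.Basis.smulTower_repr, map_smul,
      Finsupp.smul_apply, smul_eq_mul, QuadraticAlgebra.basis_repr_apply]
    have e : ∀ i, (QuadraticAlgebra.basis (1 : ℝ) 0) i = ![1, ⟨0, 1⟩] i := by
      intro i
      apply (QuadraticAlgebra.basis (1 : ℝ) 0).repr.injective
      ext j
      rw [Module.Basis.repr_self, QuadraticAlgebra.basis_repr_apply]
      fin_cases i <;> fin_cases j <;> simp [QuadraticAlgebra.re_one, QuadraticAlgebra.im_one]
    rw [e]
    fin_cases i <;> simp [QuadraticAlgebra.re_mul, QuadraticAlgebra.im_mul]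
  rw [LinearMap.trace_eq_matrix_trace ℝ ((QuadraticAlgebra.basis (1 : ℝ) 0).smulTower b),
    LinearMap.trace_eq_matrix_trace ParaComplex b, Matrix.trace, Matrix.trace,
    Fintype.sum_prod_type]
  simp only [Matrix.diag_apply, LinearMap.toMatrix_apply, LinearMap.coe_restrictScalars, h,
    Fin.sum_univ_two]
  rw [two_mul, ← QuadraticAlgebra.reₗ_apply, map_sum]
  rfl

variable {R L : Type*} [CommRing R] [AddCommGroup L] [Module R L]

/-- The Killing form of a bilinear bracket. -/
def killing (br : L →ₗ[R] L →ₗ[R] L) : L →ₗ[R] L →ₗ[R] R :=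
  ((LinearMap.mul R (Module.End R L)).compl₁₂ br br).compr₂ (LinearMap.trace R L)

lemma killing_apply (br : L →ₗ[R] L →ₗ[R] L) (a b : L) :
    killing br a b = LinearMap.trace R L (br a * br b) := rfl

lemma killing_symm (br : L →ₗ[R] L →ₗ[R] L) (a b : L) : killing br a b = killing br b a :=
  LinearMap.trace_mul_comm R _ _

/-- With A, B, C for the ad-operators, the sum is tr(ABC - BAC) + tr(BAC - BCA), which vanishes by
cyclicity. -/
lemma killing_invariant {br : L →ₗ[R] L →ₗ[R] L}
    (jac : ∀ a b c, br a (br b c) = br (br a b) c + br b (br a c)) (a b c : L) :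
    killing br (br a b) c + killing br b (br a c) = 0 := by
  have h : ∀ a b, br (br a b) = br a * br b - br b * br a := by
    intro a b
    ext c
    simp [jac a b c]
  rw [killing_apply, killing_apply, h, h, sub_mul, mul_sub, map_sub, map_sub, mul_assoc,
    LinearMap.trace_mul_comm R (br a)]
  simp only [mul_assoc]
  abel

variable {ι : Type*} [Fintype ι] (e : Module.Basis ι R L)

lemma killing_basis (br : L →ₗ[R] L →ₗ[R] L) (a b : L) :
    killing br a b =
      ∑ c, ∑ d, e.repr (br a (e d)) c * e.repr (br b (e c)) d := by
  classical
  rw [killing_apply, LinearMap.trace_eq_matrix_trace R e, LinearMap.toMatrix_mul, Matrix.trace]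
  simp only [Matrix.diag_apply, Matrix.mul_apply, LinearMap.toMatrix_apply]

lemma sum_bilin_basis (K : L →ₗ[R] L →ₗ[R] R) (x y : L) :
    ∑ p, ∑ q, K (e p) (e q) * e.repr x p * e.repr y q = K x y := by
  conv_rhs => rw [← e.sum_repr x, ← e.sum_repr y]
  simp only [map_sum, map_smul, LinearMap.sum_apply, LinearMap.smul_apply, smul_eq_mul,
    Finset.mul_sum]
  rw [Finset.sum_comm]
  refine Finset.sum_congr rfl fun q _ ↦ Finset.sum_congr rfl fun p _ ↦ ?_
  ring

/-- The coordinate row of x is annihilated by the Gram matrix. Over a ring with zero divisors, such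
as C, an invertible determinant is what makes this conclusive. -/
lemma eq_zero_of_bilin_basis_eq_zero [DecidableEq ι] (K : L →ₗ[R] L →ₗ[R] R)
    (hK : IsUnit (Matrix.of fun p q ↦ K (e p) (e q)).det) {x : L} (hx : ∀ y, K x y = 0) :
    x = 0 := by
  have h := Matrix.vecMul_injective_of_isUnit ((Matrix.isUnit_iff_isUnit_det _).2 hK)
  have h0 : (fun p ↦ e.repr x p) = 0 := by
    apply h
    ext q
    simp only [Matrix.vecMul, dotProduct, Matrix.of_apply, Pi.zero_apply, zero_mul,
      Finset.sum_const_zero]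
    have hq := hx (e q)
    rw [← sum_bilin_basis e, Finset.sum_comm, Finset.sum_eq_single q] at hq
    · rw [← hq]
      exact Finset.sum_congr rfl fun p _ ↦ by simp [mul_comm]
    · intro q' _ hq'
      simp [Finsupp.single_eq_of_ne hq']
    · simp
  apply e.repr.injective
  ext p
  simpa using congrFun h0 p

end Algebra

/-! ### The para-complex Lie algebra and its Killing form -/

section HolAlgebra

variable {E : Type*} [NormedAddCommGroup E] [NormedSpace ℝ E] [FiniteDimensional ℝ E]
  [CompleteSpace E]
  {G : Type*} [TopologicalSpace G] [ChartedSpace E G] [Group G] [LieGroup 𝓘(ℝ, E) ∞ G]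
  {J : ParaComplexStructure E G}

lemma groupBracket_skew (a b : E) : groupBracket E G a b = -groupBracket E G b a :=
  have : LieGroup 𝓘(ℝ, E) (minSmoothness ℝ 3) G := lieGroup_minSmoothness
  (lie_skew (L := GroupLieAlgebra 𝓘(ℝ, E) G) a b).symm

/-- The Lie bracket of a para-complex Lie group, as a para-complex bilinear map. -/
def IsParaComplexLieGroup.holBracket (hJ : IsParaComplexLieGroup J) :
    HolTangent J (1 : G) →ₗ[ParaComplex] HolTangent J (1 : G) →ₗ[ParaComplex]
      HolTangent J (1 : G) :=
  have smul_right : ∀ (z : ParaComplex) (a b : E),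
      groupBracket E G a (z.re • b + z.im • structureAt J 1 b) =
        z.re • groupBracket E G a b + z.im • structureAt J 1 (groupBracket E G a b) := by
    intro z a b
    rw [map_add, map_smul, map_smul, hJ.groupBracket_structureAt]
  have smul_left : ∀ (z : ParaComplex) (a b : E),
      groupBracket E G (z.re • a + z.im • structureAt J 1 a) b =
        z.re • groupBracket E G a b + z.im • structureAt J 1 (groupBracket E G a b) := by
    intro z a b
    rw [groupBracket_skew, smul_right, groupBracket_skew a b, map_neg]
    module
  LinearMap.mk₂ ParaComplex (fun a b ↦ groupBracket E G (show E from a) (show E from b))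
    (fun a b c ↦ congrArg (fun A : E →L[ℝ] E ↦ A c)
      (map_add (groupBracket E G) (show E from a) (show E from b)))
    smul_left
    (fun a b c ↦ map_add (groupBracket E G (show E from a)) (show E from b) (show E from c))
    (fun z a b ↦ smul_right z a b)

lemma IsParaComplexLieGroup.holBracket_leibniz (hJ : IsParaComplexLieGroup J)
    (a b c : HolTangent J (1 : G)) :
    hJ.holBracket a (hJ.holBracket b c) =
      hJ.holBracket (hJ.holBracket a b) c + hJ.holBracket b (hJ.holBracket a c) :=
  groupBracket_leibniz (E := E) a b c

variable {ι : Type*} [Fintype ι] (e : Module.Basis ι ParaComplex (HolTangent J (1 : G)))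

/-- The structure constants are the matrix entries of ad e_b, so the contraction of indices is a
trace. -/
lemma IsParaComplexLieGroup.cartanKilling_apply (hJ : IsParaComplexLieGroup J) (p q : ι) :
    cartanKilling J e p q = killing hJ.holBracket (e p) (e q) := by
  rw [killing_basis e]
  rfl

/-- The Cartan-Killing metric is the Killing form, transported by right translations. -/
lemma IsParaComplexLieGroup.killingMetric_apply (hJ : IsParaComplexLieGroup J) (z : G)
    (u v : TangentSpace 𝓘(ℝ, E) z) :
    killingMetric J e z u v = killing hJ.holBracket (toHol J (rightCoframe (E := E) z u))
      (toHol J (rightCoframe (E := E) z v)) := by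
  rw [← sum_bilin_basis e]
  simp only [← hJ.cartanKilling_apply e]
  rfl

end HolAlgebra

/-! ### The Cartan-Killing metric -/

section KillingMetric

variable {E : Type*} [NormedAddCommGroup E] [NormedSpace ℝ E] [FiniteDimensional ℝ E]
  [CompleteSpace E]
  {G : Type*} [TopologicalSpace G] [ChartedSpace E G] [Group G] [LieGroup 𝓘(ℝ, E) ∞ G]
  {J : ParaComplexStructure E G}

instance (x : G) : Module ℝ (HolTangent J x) :=
  inferInstanceAs (Module ℝ (TangentSpace 𝓘(ℝ, E) x))

instance (x : G) : IsScalarTower ℝ ParaComplex (HolTangent J x) where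
  smul_assoc r z v := by
    change (r • z).re • ofHol J v + (r • z).im • J.toFun x (ofHol J v) =
      r • (z.re • ofHol J v + z.im • J.toFun x (ofHol J v))
    rw [QuadraticAlgebra.re_smul, QuadraticAlgebra.im_smul, smul_add, smul_smul, smul_smul]
    rfl

lemma unitE_smul (v : E) :
    unitE • toHol J (x := (1 : G)) v = toHol J (x := (1 : G)) (structureAt J 1 v) := by
  change (0 : ℝ) • v + (1 : ℝ) • structureAt J 1 v = structureAt J 1 v
  simp

/-- The Killing form on the Lie algebra of `G`, as a real bilinear map on the model space. -/
def IsParaComplexLieGroup.groupKilling (hJ : IsParaComplexLieGroup J) :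
    E →ₗ[ℝ] E →ₗ[ℝ] ParaComplex :=
  LinearMap.mk₂ ℝ
    (fun a b ↦ killing hJ.holBracket (toHol J (x := (1 : G)) a) (toHol J (x := (1 : G)) b))
    (fun a b c ↦ LinearMap.map_add₂ (killing hJ.holBracket)
      (toHol J (x := (1 : G)) a) (toHol J (x := (1 : G)) b) (toHol J (x := (1 : G)) c))
    (fun r a b ↦ congrArg (fun f ↦ f (toHol J (x := (1 : G)) b))
      ((killing hJ.holBracket).map_smul_of_tower r (toHol J (x := (1 : G)) a)))
    (fun a b c ↦ map_add (killing hJ.holBracket (toHol J (x := (1 : G)) a))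
      (toHol J (x := (1 : G)) b) (toHol J (x := (1 : G)) c))
    (fun r a b ↦ (killing hJ.holBracket (toHol J (x := (1 : G)) a)).map_smul_of_tower r
      (toHol J (x := (1 : G)) b))

namespace IsParaComplexLieGroup

lemma groupKilling_symm (hJ : IsParaComplexLieGroup J) (a b : E) :
    hJ.groupKilling a b = hJ.groupKilling b a :=
  killing_symm (L := HolTangent J (1 : G)) _ _ _

lemma groupKilling_invariant (hJ : IsParaComplexLieGroup J) (a b c : E) :
    hJ.groupKilling (groupBracket E G a b) c + hJ.groupKilling b (groupBracket E G a c) = 0 :=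
  killing_invariant (L := HolTangent J (1 : G)) hJ.holBracket_leibniz a b c

lemma groupKilling_structureAt (hJ : IsParaComplexLieGroup J) (a b : E) :
    hJ.groupKilling (structureAt J 1 a) b = unitE * hJ.groupKilling a b := by
  change killing hJ.holBracket (toHol J (x := (1 : G)) (structureAt J 1 a)) _ = _
  rw [← unitE_smul]
  exact congrArg (fun f ↦ f (toHol J (x := (1 : G)) b))
    (map_smul (killing hJ.holBracket) unitE (toHol J (x := (1 : G)) a))

lemma groupKilling_structureAt_right (hJ : IsParaComplexLieGroup J) (a b : E) :
    hJ.groupKilling a (structureAt J 1 b) = unitE * hJ.groupKilling a b := by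
  rw [groupKilling_symm, groupKilling_structureAt, groupKilling_symm]

lemma eq_zero_of_groupKilling_eq_zero (hJ : IsParaComplexLieGroup J)
    {ι : Type*} [Fintype ι] [DecidableEq ι]
    {e : Module.Basis ι ParaComplex (HolTangent J (1 : G))} (hss : IsParaSemisimple J e) {a : E}
    (ha : ∀ b, hJ.groupKilling a b = 0) : a = 0 := by
  refine eq_zero_of_bilin_basis_eq_zero e (killing hJ.holBracket) ?_
    (x := toHol J (x := (1 : G)) a) ha
  have h : cartanKilling J e = Matrix.of fun p q ↦ killing hJ.holBracket (e p) (e q) := by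
    ext1 p q
    exact hJ.cartanKilling_apply e p q
  rw [← h]
  exact hss

/-- A component of the Killing form. -/
def killingPart (hJ : IsParaComplexLieGroup J) (φ : ParaComplex →ₗ[ℝ] ℝ) : E →L[ℝ] E →L[ℝ] ℝ :=
  LinearMap.toContinuousBilinearMap (hJ.groupKilling.compr₂ φ)

lemma killingPart_invariant (hJ : IsParaComplexLieGroup J) (φ : ParaComplex →ₗ[ℝ] ℝ) (a b c : E) :
    hJ.killingPart φ ((rightParallelism E G).bracket a b) c +
      hJ.killingPart φ b ((rightParallelism E G).bracket a c) = 0 := by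
  have h := congrArg φ (hJ.groupKilling_invariant a b c)
  rw [map_add, map_zero] at h
  change hJ.killingPart φ (-groupBracket E G a b) c +
    hJ.killingPart φ b (-groupBracket E G a c) = 0
  rw [map_neg, map_neg, neg_apply, ← neg_add, neg_eq_zero]
  exact h

lemma paraDeriv_groupKilling (hJ : IsParaComplexLieGroup J) {f g : G → E} {x : G}
    (hf : MDifferentiableAt 𝓘(ℝ, E) 𝓘(ℝ, E) f x) (hg : MDifferentiableAt 𝓘(ℝ, E) 𝓘(ℝ, E) g x)
    (v : TangentSpace 𝓘(ℝ, E) x) :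
    paraDeriv (fun y ↦ hJ.groupKilling (f y) (g y)) x v =
      hJ.groupKilling (mvfderiv 𝓘(ℝ, E) f x v) (g x) +
        hJ.groupKilling (f x) (mvfderiv 𝓘(ℝ, E) g x v) :=
  QuadraticAlgebra.ext (mvfderiv_bilin (hJ.killingPart (QuadraticAlgebra.reₗ 1 0)) hf hg v)
    (mvfderiv_bilin (hJ.killingPart (QuadraticAlgebra.imₗ 1 0)) hf hg v)

variable {ι : Type*} [Fintype ι] (e : Module.Basis ι ParaComplex (HolTangent J (1 : G)))

lemma killingMetric_eq (hJ : IsParaComplexLieGroup J) (z : G) (u v : TangentSpace 𝓘(ℝ, E) z) :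
    killingMetric J e z u v = hJ.groupKilling ((rightParallelism E G).coframe z u)
      ((rightParallelism E G).coframe z v) :=
  hJ.killingMetric_apply e z u v

lemma twoRe_killingMetric (hJ : IsParaComplexLieGroup J) (z : G) (u v : TangentSpace 𝓘(ℝ, E) z) :
    twoRe (killingMetric J e) z u v =
      ((2 : ℝ) • hJ.killingPart (QuadraticAlgebra.reₗ 1 0))
        ((rightParallelism E G).coframe z u) ((rightParallelism E G).coframe z v) := by
  change (2 : ℝ) • (killingMetric J e z u v).re = _
  rw [hJ.killingMetric_eq]
  rfl

lemma coframe_apply (hJ : IsParaComplexLieGroup J) (z : G) (v : TangentSpace 𝓘(ℝ, E) z) :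
    (rightParallelism E G).coframe z (J.toFun z v) =
      structureAt J 1 ((rightParallelism E G).coframe z v) :=
  hJ.rightCoframe_apply z v

lemma bracket_structureAt (hJ : IsParaComplexLieGroup J) (a b : E) :
    (rightParallelism E G).bracket a (structureAt J 1 b) =
      structureAt J 1 ((rightParallelism E G).bracket a b) := by
  change -groupBracket E G a (structureAt J 1 b) = structureAt J 1 (-groupBracket E G a b)
  rw [hJ.groupBracket_structureAt, map_neg]

/-- The Cauchy–Riemann equations for the components of a para-holomorphic field. The condition [X,
JA] = J[X, A] is tested on the right-invariant field A through v; the algebraic bracket terms cancel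
by para-complex linearity and the derivative terms remain. -/
lemma mvfderiv_coframe_structure (hJ : IsParaComplexLieGroup J)
    {X : ∀ y : G, TangentSpace 𝓘(ℝ, E) y} {x : G}
    (hX : IsParaHolomorphicFieldAt J X x) (v : TangentSpace 𝓘(ℝ, E) x) :
    mvfderiv 𝓘(ℝ, E) (fun y ↦ (rightParallelism E G).coframe y (X y)) x (J.toFun x v) =
      structureAt J 1
        (mvfderiv 𝓘(ℝ, E) (fun y ↦ (rightParallelism E G).coframe y (X y)) x v) := by
  set P := rightParallelism E G with hP
  have sm : ∀ a : E, CMDiffAt ∞ (T% (fun y ↦ (P.coframe y).symm a)) x :=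
    fun a ↦ P.contMDiffAt_frame contMDiffAt_const
  have dX := hX.1.mdifferentiableAt (n := ∞) (by simp)
  have br : ∀ a : E,
      P.coframe x (VectorField.mlieBracket 𝓘(ℝ, E) X (fun y ↦ (P.coframe y).symm a) x) =
        -mvfderiv 𝓘(ℝ, E) (fun y ↦ P.coframe y (X y)) x ((P.coframe x).symm a) +
          P.bracket (P.coframe x (X x)) a := by
    intro a
    rw [P.coframe_mlieBracket_of_mdifferentiableAt dX ((sm a).mdifferentiableAt (by simp)),
      P.mvfderiv_coframe_frame, zero_apply, zero_sub, ContinuousLinearEquiv.apply_symm_apply]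
  have frame : ∀ (y : G) (a : E),
      J.toFun y ((P.coframe y).symm a) = (P.coframe y).symm (structureAt J 1 a) := by
    intro y a
    apply (P.coframe y).injective
    rw [hP, hJ.coframe_apply, ContinuousLinearEquiv.apply_symm_apply,
      ContinuousLinearEquiv.apply_symm_apply]
  have h := congrArg (P.coframe x) (hX.2.self_of_nhds _ (sm (P.coframe x v)))
  simp only [frame] at h
  rw [hP, hJ.coframe_apply, ← hP, br, br, ← frame, hP, hJ.bracket_structureAt, ← hP, map_add,
    map_neg, ContinuousLinearEquiv.symm_apply_apply] at h
  exact neg_injective (add_right_cancel h)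

variable [DecidableEq ι] {e}

theorem isParaHolomorphicMetric_killingMetric (hJ : IsParaComplexLieGroup J)
    (hss : IsParaSemisimple J e) : IsParaHolomorphicMetric J (killingMetric J e) where
  symm x u v := by
    rw [hJ.killingMetric_eq, hJ.killingMetric_eq, hJ.groupKilling_symm]
  unitE_mul x u v := by
    rw [hJ.killingMetric_eq, hJ.killingMetric_eq, hJ.coframe_apply, hJ.groupKilling_structureAt]
  nondegenerate x u hu := by
    apply ((rightParallelism E G).coframe x).injective
    rw [map_zero]
    refine hJ.eq_zero_of_groupKilling_eq_zero hss fun b ↦ ?_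
    have h := hu (((rightParallelism E G).coframe x).symm b)
    rwa [hJ.killingMetric_eq, ContinuousLinearEquiv.apply_symm_apply] at h
  smooth x X Y hX hY := by
    simp only [hJ.killingMetric_eq]
    have h1 := (rightParallelism E G).contMDiffAt_coframe hX
    have h2 := (rightParallelism E G).contMDiffAt_coframe hY
    exact ⟨contMDiffAt_bilin (hJ.killingPart (QuadraticAlgebra.reₗ 1 0)) h1 h2,
      contMDiffAt_bilin (hJ.killingPart (QuadraticAlgebra.imₗ 1 0)) h1 h2⟩
  paraHolomorphic x X Y hX hY v := by
    simp only [hJ.killingMetric_eq]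
    have h1 := (rightParallelism E G).mdifferentiableAt_coframe
      (hX.1.mdifferentiableAt (by simp))
    have h2 := (rightParallelism E G).mdifferentiableAt_coframe
      (hY.1.mdifferentiableAt (by simp))
    rw [hJ.paraDeriv_groupKilling h1 h2, hJ.paraDeriv_groupKilling h1 h2,
      hJ.mvfderiv_coframe_structure hX, hJ.mvfderiv_coframe_structure hY,
      hJ.groupKilling_structureAt, hJ.groupKilling_structureAt_right, mul_add]

end IsParaComplexLieGroup

end KillingMetric

/-! ### Ricci tensors, Levi-Civita connections and the Einstein equations -/

section Einstein

variable {E : Type*} [NormedAddCommGroup E] [NormedSpace ℝ E] [FiniteDimensional ℝ E]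
  [CompleteSpace E]
  {G : Type*} [TopologicalSpace G] [ChartedSpace E G] [Group G] [LieGroup 𝓘(ℝ, E) ∞ G]
  {J : ParaComplexStructure E G}

variable (E G) in
lemma rightParallelism_leibniz (a b c : E) :
    (rightParallelism E G).bracket a ((rightParallelism E G).bracket b c) =
      (rightParallelism E G).bracket ((rightParallelism E G).bracket a b) c +
        (rightParallelism E G).bracket b ((rightParallelism E G).bracket a c) := by
  change -groupBracket E G a (-groupBracket E G b c) =
    -groupBracket E G (-groupBracket E G a b) c + -groupBracket E G b (-groupBracket E G a c)
  simp only [map_neg, neg_apply, neg_neg]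
  exact groupBracket_leibniz a b c

/-- Antisymmetry, used twice, turns [[w,u],v] into [v,[u,w]]. This exhibits w ↦ R(w,u)v as a
multiple of ad v ∘ ad u, whose trace is the Killing form. -/
lemma coframe_curvatureAt_rightParallelism {cov : AffineConnection E G}
    (h : ∀ (y : G) (Y : ∀ y : G, TangentSpace 𝓘(ℝ, E) y), MDiffAt (T% Y) y →
      cov Y y = (rightParallelism E G).connection Y y) (x : G)
    (w u v : TangentSpace 𝓘(ℝ, E) x) :
    (rightParallelism E G).coframe x (curvatureAt cov x w u v) =
      -(1 / 4 : ℝ) • groupBracket E G ((rightParallelism E G).coframe x v)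
        (groupBracket E G ((rightParallelism E G).coframe x u)
          ((rightParallelism E G).coframe x w)) := by
  rw [(rightParallelism E G).coframe_curvatureAt (rightParallelism_leibniz E G) h]
  congr 1
  change -groupBracket E G (-groupBracket E G _ _) _ = _
  rw [map_neg, neg_apply, neg_neg, groupBracket_skew, groupBracket_skew _
    ((rightParallelism E G).coframe x u), map_neg, neg_neg]

namespace IsParaComplexLieGroup

/-- Right translation to the identity, as a para-complex linear map. -/
def holCoframe (hJ : IsParaComplexLieGroup J) (x : G) :
    HolTangent J x ≃ₗ[ParaComplex] HolTangent J (1 : G) where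
  toFun v := toHol J (x := (1 : G)) ((rightParallelism E G).coframe x (ofHol J v))
  invFun v := toHol J (((rightParallelism E G).coframe x).symm (show E from v))
  left_inv v := ((rightParallelism E G).coframe x).symm_apply_apply v
  right_inv v := ((rightParallelism E G).coframe x).apply_symm_apply v
  map_add' u v := map_add ((rightParallelism E G).coframe x) (ofHol J u) (ofHol J v)
  map_smul' z v := by
    change (rightParallelism E G).coframe x (z.re • ofHol J v + z.im • J.toFun x (ofHol J v)) =
      z.re • (rightParallelism E G).coframe x (ofHol J v) +
        z.im • structureAt J 1 ((rightParallelism E G).coframe x (ofHol J v))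
    rw [map_add, map_smul, map_smul, hJ.coframe_apply]

/-- The endomorphism `w ↦ R(w, u) v` of the para-holomorphic tangent space. -/
def ricciEnd (hJ : IsParaComplexLieGroup J) {x : G} (u v : TangentSpace 𝓘(ℝ, E) x) :
    Module.End ParaComplex (HolTangent J x) :=
  (hJ.holCoframe x).symm.conj ((-(1 / 4 : ℝ) • 1 : ParaComplex) •
    (hJ.holBracket (hJ.holCoframe x (toHol J v)) * hJ.holBracket (hJ.holCoframe x (toHol J u))))

lemma trace_ricciEnd (hJ : IsParaComplexLieGroup J) {ι : Type*} [Fintype ι]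
    (e : Module.Basis ι ParaComplex (HolTangent J (1 : G))) {x : G}
    (u v : TangentSpace 𝓘(ℝ, E) x) :
    LinearMap.trace ParaComplex (HolTangent J x) (hJ.ricciEnd u v) =
      (-(1 / 4 : ℝ) • 1 : ParaComplex) * killingMetric J e x u v := by
  rw [ricciEnd, LinearMap.trace_conj', map_smul, smul_eq_mul, hJ.killingMetric_eq,
    hJ.groupKilling_symm]
  rfl

lemma ricciEnd_apply (hJ : IsParaComplexLieGroup J) {cov : AffineConnection E G}
    (h : ∀ (y : G) (Y : ∀ y : G, TangentSpace 𝓘(ℝ, E) y), MDiffAt (T% Y) y →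
      cov Y y = (rightParallelism E G).connection Y y) {x : G}
    (w u v : TangentSpace 𝓘(ℝ, E) x) :
    hJ.ricciEnd u v (toHol J w) = toHol J (curvatureAt cov x w u v) := by
  apply (hJ.holCoframe x).injective
  rw [ricciEnd, LinearEquiv.conj_apply_apply, LinearEquiv.symm_symm, LinearEquiv.apply_symm_apply,
    LinearMap.smul_apply, smul_assoc, one_smul]
  exact (coframe_curvatureAt_rightParallelism h x w u v).symm

lemma paraRicci_eq (hJ : IsParaComplexLieGroup J) {ι κ : Type*} [Fintype ι] [Fintype κ]
    (e : Module.Basis ι ParaComplex (HolTangent J (1 : G))) {cov : AffineConnection E G}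
    (h : ∀ (y : G) (Y : ∀ y : G, TangentSpace 𝓘(ℝ, E) y), MDiffAt (T% Y) y →
      cov Y y = (rightParallelism E G).connection Y y) {x : G}
    (b : Module.Basis κ ParaComplex (HolTangent J x)) (u v : TangentSpace 𝓘(ℝ, E) x) :
    paraRicci J cov b u v = (-(1 / 4 : ℝ) • 1 : ParaComplex) * killingMetric J e x u v := by
  classical
  rw [← hJ.trace_ricciEnd, LinearMap.trace_eq_matrix_trace ParaComplex b, Matrix.trace, paraRicci]
  simp only [Matrix.diag_apply, LinearMap.toMatrix_apply, ← hJ.ricciEnd_apply h]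
  rfl

/-- The Ricci endomorphism is C-linear, so its real trace is twice the real part of the para-complex
trace; this factor 2 is the one in ds² = 2 Re ĝ. -/
lemma ricci_eq (hJ : IsParaComplexLieGroup J) {ι κ : Type*} [Fintype ι] [Fintype κ]
    (e : Module.Basis ι ParaComplex (HolTangent J (1 : G))) {cov : AffineConnection E G}
    (h : ∀ (y : G) (Y : ∀ y : G, TangentSpace 𝓘(ℝ, E) y), MDiffAt (T% Y) y →
      cov Y y = (rightParallelism E G).connection Y y) {x : G}
    (b : Module.Basis κ ℝ (TangentSpace 𝓘(ℝ, E) x)) (u v : TangentSpace 𝓘(ℝ, E) x) :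
    ricci cov b u v = -(1 / 4) * twoRe (killingMetric J e) x u v := by
  classical
  let b' : Module.Basis κ ℝ (HolTangent J x) := b
  have h1 : ricci cov b u v =
      LinearMap.trace ℝ (HolTangent J x) ((hJ.ricciEnd u v).restrictScalars ℝ) := by
    rw [LinearMap.trace_eq_matrix_trace ℝ b', Matrix.trace, ricci]
    simp only [Matrix.diag_apply, LinearMap.toMatrix_apply]
    refine Finset.sum_congr rfl fun i _ ↦ ?_
    exact congrArg (fun w ↦ b.repr w i) (hJ.ricciEnd_apply h (b i) u v).symm
  rw [h1, trace_restrictScalars_paraComplex (e.map (hJ.holCoframe x).symm), hJ.trace_ricciEnd e,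
    smul_mul_assoc, one_mul, QuadraticAlgebra.re_smul]
  change _ = -(1 / 4) * ((2 : ℝ) • (killingMetric J e x u v).re)
  simp only [smul_eq_mul]
  ring

variable {ι : Type*} [Fintype ι] [DecidableEq ι]
  {e : Module.Basis ι ParaComplex (HolTangent J (1 : G))}

lemma isLeviCivita_rightParallelism (hJ : IsParaComplexLieGroup J) :
    IsLeviCivita (twoRe (killingMetric J e)) (rightParallelism E G).connection := by
  refine (rightParallelism E G).isLeviCivita_connection
    (β := (2 : ℝ) • hJ.killingPart (QuadraticAlgebra.reₗ 1 0)) (fun a b c ↦ ?_)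
    (hJ.twoRe_killingMetric e)
  rw [smul_apply, smul_apply, smul_apply, smul_apply, ← smul_add, hJ.killingPart_invariant,
    smul_zero]

/-- Re(ez) = Im z: the real metric recovers the imaginary part of ĝ through J, and so inherits its
nondegeneracy. -/
lemma twoRe_structure (hJ : IsParaComplexLieGroup J) (hss : IsParaSemisimple J e) (x : G)
    (u v : TangentSpace 𝓘(ℝ, E) x) :
    twoRe (killingMetric J e) x (J.toFun x u) v = 2 * (killingMetric J e x u v).im := by
  change (2 : ℝ) • (killingMetric J e x (J.toFun x u) v).re = _
  rw [(hJ.isParaHolomorphicMetric_killingMetric hss).unitE_mul, QuadraticAlgebra.re_mul]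
  simp [unitE]

lemma twoRe_symm (hJ : IsParaComplexLieGroup J) (hss : IsParaSemisimple J e) (x : G)
    (u v : TangentSpace 𝓘(ℝ, E) x) :
    twoRe (killingMetric J e) x u v = twoRe (killingMetric J e) x v u := by
  change (2 : ℝ) • (killingMetric J e x u v).re = (2 : ℝ) • (killingMetric J e x v u).re
  rw [(hJ.isParaHolomorphicMetric_killingMetric hss).symm]

lemma eq_zero_of_twoRe_eq_zero (hJ : IsParaComplexLieGroup J) (hss : IsParaSemisimple J e) (x : G)
    (u : TangentSpace 𝓘(ℝ, E) x) (hu : ∀ v, twoRe (killingMetric J e) x u v = 0) : u = 0 := by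
  refine (hJ.isParaHolomorphicMetric_killingMetric hss).nondegenerate x u fun v ↦ ?_
  have h1 : (2 : ℝ) • (killingMetric J e x u v).re = 0 := hu v
  have h2 := hu (J.toFun x v)
  rw [hJ.twoRe_symm hss, hJ.twoRe_structure hss,
    (hJ.isParaHolomorphicMetric_killingMetric hss).symm] at h2
  refine QuadraticAlgebra.ext ?_ ?_
  · simpa using h1
  · simpa using h2

lemma eq_connection_of_isLeviCivita (hJ : IsParaComplexLieGroup J) (hss : IsParaSemisimple J e)
    {cov : AffineConnection E G} (h : IsLeviCivita (twoRe (killingMetric J e)) cov) (y : G)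
    (Y : ∀ y : G, TangentSpace 𝓘(ℝ, E) y) (hY : MDiffAt (T% Y) y) :
    cov Y y = (rightParallelism E G).connection Y y :=
  IsLeviCivita.apply_eq (hJ.twoRe_symm hss) (hJ.eq_zero_of_twoRe_eq_zero hss) h
    hJ.isLeviCivita_rightParallelism hY

lemma connection_structure (hJ : IsParaComplexLieGroup J) {x : G}
    {Y : ∀ y : G, TangentSpace 𝓘(ℝ, E) y} (hY : MDiffAt (T% Y) x) (v : TangentSpace 𝓘(ℝ, E) x) :
    (rightParallelism E G).connection (fun y ↦ J.toFun y (Y y)) x v =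
      J.toFun x ((rightParallelism E G).connection Y x v) := by
  apply ((rightParallelism E G).coframe x).injective
  rw [hJ.coframe_apply, Parallelism.coframe_connection, Parallelism.coframe_connection]
  simp only [hJ.coframe_apply]
  rw [mvfderiv_clm_comp _ ((rightParallelism E G).mdifferentiableAt_coframe hY),
    hJ.bracket_structureAt, map_add, map_smul]

lemma mdifferentiableAt_structure (hJ : IsParaComplexLieGroup J) {x : G}
    {Y : ∀ y : G, TangentSpace 𝓘(ℝ, E) y} (hY : MDiffAt (T% Y) x) :
    MDiffAt (T% (fun y ↦ J.toFun y (Y y))) x := by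
  have h1 : MDifferentiableAt 𝓘(ℝ, E) 𝓘(ℝ, E)
      (fun y ↦ structureAt J 1 ((rightParallelism E G).coframe y (Y y))) x :=
    (structureAt J 1).mdifferentiableAt.comp x
      ((rightParallelism E G).mdifferentiableAt_coframe hY)
  have h2 := (rightParallelism E G).mdifferentiableAt_frame h1
  simpa only [← hJ.coframe_apply, ContinuousLinearEquiv.symm_apply_apply] using h2

lemma isParaLeviCivita_connection (hJ : IsParaComplexLieGroup J) :
    IsParaLeviCivita J (killingMetric J e) (rightParallelism E G).connection := by
  refine ⟨Parallelism.torsion_connection _, fun x Y hY v ↦ hJ.connection_structure hY v,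
    fun x X Y hX hY v ↦ ?_⟩
  simp only [hJ.killingMetric_eq]
  exact QuadraticAlgebra.ext
    ((rightParallelism E G).mvfderiv_bilin_connection
      (hJ.killingPart_invariant (QuadraticAlgebra.reₗ 1 0)) hX hY v)
    ((rightParallelism E G).mvfderiv_bilin_connection
      (hJ.killingPart_invariant (QuadraticAlgebra.imₗ 1 0)) hX hY v)

/-- Taking real parts of ∇ĝ = 0. Uniqueness of the connection for ĝ is thereby reduced to uniqueness
for the real metric. -/
lemma isLeviCivita_of_isParaLeviCivita (hJ : IsParaComplexLieGroup J)
    {cov : AffineConnection E G} (h : IsParaLeviCivita J (killingMetric J e) cov) :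
    IsLeviCivita (twoRe (killingMetric J e)) cov := by
  refine ⟨h.1, fun x X Y hX hY v ↦ ?_⟩
  have h1 := congrArg QuadraticAlgebra.re (h.2.2 x X Y hX hY v)
  have hd : MDifferentiableAt 𝓘(ℝ, E) 𝓘(ℝ, ℝ)
      (fun y ↦ (killingMetric J e y (X y) (Y y)).re) x := by
    simp only [hJ.killingMetric_eq]
    exact mdifferentiableAt_bilin (hJ.killingPart (QuadraticAlgebra.reₗ 1 0))
      ((rightParallelism E G).mdifferentiableAt_coframe hX)
      ((rightParallelism E G).mdifferentiableAt_coframe hY)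
  have h2 := mvfderiv_clm_comp ((2 : ℝ) • ContinuousLinearMap.id ℝ ℝ) hd v
  refine h2.trans ?_
  change (2 : ℝ) • (mvfderiv 𝓘(ℝ, E) (fun y ↦ (killingMetric J e y (X y) (Y y)).re) x v) =
    (2 : ℝ) • (killingMetric J e x (cov X x v) (Y x)).re +
      (2 : ℝ) • (killingMetric J e x (X x) (cov Y x v)).re
  rw [← smul_add]
  exact congrArg _ h1

theorem isParaHolomorphicEinsteinWith_killingMetric (hJ : IsParaComplexLieGroup J)
    (hss : IsParaSemisimple J e) :
    IsParaHolomorphicEinsteinWith J (killingMetric J e) (-(1 / 4 : ℝ) • 1) :=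
  ⟨⟨_, hJ.isParaLeviCivita_connection⟩, fun _ h _ _ b u v ↦ hJ.paraRicci_eq e
    (hJ.eq_connection_of_isLeviCivita hss (hJ.isLeviCivita_of_isParaLeviCivita h)) b u v⟩

theorem isParaKahlerNorden_twoRe_killingMetric (hJ : IsParaComplexLieGroup J)
    (hss : IsParaSemisimple J e) : IsParaKahlerNorden J (twoRe (killingMetric J e)) where
  symm := hJ.twoRe_symm hss
  nondegenerate x := ⟨fun u hu ↦ hJ.eq_zero_of_twoRe_eq_zero hss x u hu,
    fun u hu ↦ hJ.eq_zero_of_twoRe_eq_zero hss x u fun v ↦ (hJ.twoRe_symm hss x u v).trans (hu v)⟩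
  smooth x X Y hX hY := by
    simp only [hJ.twoRe_killingMetric]
    exact contMDiffAt_bilin _ ((rightParallelism E G).contMDiffAt_coframe hX)
      ((rightParallelism E G).contMDiffAt_coframe hY)
  compat x u v := by
    -- ds²(Ju, Jv) = 2 Im ĝ(u, Jv) = 2 Im(e ĝ(u,v)) = 2 Re ĝ(u,v).
    rw [hJ.twoRe_structure hss, (hJ.isParaHolomorphicMetric_killingMetric hss).symm,
      (hJ.isParaHolomorphicMetric_killingMetric hss).unitE_mul,
      (hJ.isParaHolomorphicMetric_killingMetric hss).symm]
    change _ = (2 : ℝ) • (killingMetric J e x u v).re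
    simp [unitE, QuadraticAlgebra.im_mul]
  exists_leviCivita := ⟨_, hJ.isLeviCivita_rightParallelism⟩
  parallel cov h x Y hY v := by
    have h' := hJ.eq_connection_of_isLeviCivita hss h
    rw [h' x _ (hJ.mdifferentiableAt_structure hY), h' x Y hY, hJ.connection_structure hY]

theorem isEinsteinWith_twoRe_killingMetric (hJ : IsParaComplexLieGroup J)
    (hss : IsParaSemisimple J e) : IsEinsteinWith (twoRe (killingMetric J e)) (-(1 / 4)) :=
  ⟨⟨_, hJ.isLeviCivita_rightParallelism⟩, fun _ h _ _ b u v ↦ hJ.ricci_eq e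
    (hJ.eq_connection_of_isLeviCivita hss h) b u v⟩

end IsParaComplexLieGroup

end Einstein

end ParaComplexGeometry

end

open ParaComplexGeometry in
theorem mainTheorem3 {E : Type*} [NormedAddCommGroup E] [NormedSpace ℝ E] [FiniteDimensional ℝ E]
    [CompleteSpace E]
    {G : Type*} [TopologicalSpace G] [ChartedSpace E G] [Group G] [LieGroup 𝓘(ℝ, E) ∞ G]
    (J : ParaComplexStructure E G) (hJ : IsParaComplexLieGroup J)
    (m : ℕ) (e : Module.Basis (Fin m) ParaComplex (HolTangent J (1 : G)))
    (hss : IsParaSemisimple J e) :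
    IsParaHolomorphicMetric J (killingMetric J e) ∧
    IsParaHolomorphicEinsteinWith J (killingMetric J e) (-(1 / 4 : ℝ) • 1) ∧
    IsParaKahlerNorden J (twoRe (killingMetric J e)) ∧
    IsEinsteinWith (twoRe (killingMetric J e)) (-(1 / 4)) :=
  ⟨hJ.isParaHolomorphicMetric_killingMetric hss,
    hJ.isParaHolomorphicEinsteinWith_killingMetric hss,
    hJ.isParaKahlerNorden_twoRe_killingMetric hss, hJ.isEinsteinWith_twoRe_killingMetric hss⟩
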